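/- Let $\Omega$ be a Cantor group, that is, a compact, totally disconnected (Hausdorff) topological group without isolated points, and assume that $\Omega$ is monothetic (hence abelian, written additively): there is $\alpha\in\Omega$ such that $\{n\alpha : n\in\mathbb{Z}\}$ is dense in $\Omega$. Fix such an $\alpha$. For $f\in C(\Omega,\mathbb{R})$ and $\omega\in\Omega$, let $H_{\omega,f}$ be the bounded self-adjoint operator on $\ell^2(\mathbb{Z})$ given by $$[H_{\omega,f}\psi](n)=\psi(n-1)+\psi(n+1)+f(\omega+n\alpha)\,\psi(n),\qquad n\in\mathbb{Z}.$$ Then there exists a dense $G_\delta$ set $\mathcal{S}\subseteq C(\Omega,\mathbb{R})$ (with respect to the uniform topology) such that for every $f\in\mathcal{S}$ and every $\omega\in\Omega$, the spectrum of $H_{\omega,f}$ is a Cantor set (a nonempty, compact, perfect, totally disconnected subset of $\mathbb{R}$) of zero Lebesgue measure, and $H_{\omega,f}$ has purely singular continuous spectrum, that is, for every $\psi\in\ell^2(\mathbb{Z})$ the spectral measure of $H_{\omega,f}$ and $\psi$ has no atoms and is singular with respect to Lebesgue measure. -/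

import Mathlib

open MeasureTheory
open scoped ENNReal Topology BoundedContinuousFunction CompactlySupported InnerProductSpace

noncomputable section

namespace LimitPeriodic

/-- The complex Hilbert space `ℓ²(ℤ)`. -/
abbrev EllTwo : Type := lp (fun _ : ℤ => ℂ) 2

/-! ### Discrete Schrödinger operators on `ℓ²(ℤ)` -/

/-- `(translation k ψ)(n) = ψ(n + k)`. -/
def translation (k : ℤ) : EllTwo →L[ℂ] EllTwo :=
  LinearMap.mkContinuous
    { toFun := fun ψ => ⟨fun n => ψ (n + k), by
        have h := (lp.memℓp ψ).summable (by norm_num)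
        exact memℓp_gen ((Equiv.addRight k).summable_iff.mpr h)⟩
      map_add' := fun _ _ => rfl
      map_smul' := fun _ _ => rfl }
    1 (by
      intro ψ
      rw [one_mul]
      refine lp.norm_le_of_tsum_le (by norm_num) (norm_nonneg ψ) ?_
      rw [lp.norm_rpow_eq_tsum (by norm_num) ψ]
      exact ((Equiv.addRight k).tsum_eq (fun n => ‖ψ n‖ ^ (2 : ℝ≥0∞).toReal)).le)

/-- `(multiplication V ψ)(n) = V(n) ψ(n)` for a bounded real potential `V` on `ℤ`. -/
def multiplication (V : ℤ →ᵇ ℝ) : EllTwo →L[ℂ] EllTwo :=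
  have bound (ψ : EllTwo) (n : ℤ) : ‖(V n : ℂ) * ψ n‖ ≤ ‖(((‖V‖ : ℝ) : ℂ) • ψ) n‖ := by
    simp only [lp.coeFn_smul, Pi.smul_apply, norm_smul, norm_mul, Complex.norm_real, norm_norm]
    gcongr
    exact V.norm_coe_le_norm n
  LinearMap.mkContinuous
    { toFun := fun ψ => ⟨fun n => (V n : ℂ) * ψ n, (lp.memℓp (((‖V‖ : ℝ) : ℂ) • ψ)).mono' (bound ψ)⟩
      map_add' := fun ψ φ => by ext n; exact mul_add _ (ψ n) (φ n)
      map_smul' := fun c ψ => by ext n; exact mul_left_comm _ c (ψ n) }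
    ‖V‖ (by
      intro ψ
      refine (lp.norm_mono (by norm_num) (bound ψ)).trans ?_
      rw [norm_smul, Complex.norm_real, norm_norm])

/-- The discrete Schrödinger operator `H = Δ + V` on `ℓ²(ℤ)`; see `schrodinger_apply`. -/
def schrodinger (V : ℤ →ᵇ ℝ) : EllTwo →L[ℂ] EllTwo :=
  translation (-1) + translation 1 + multiplication V

theorem schrodinger_apply (V : ℤ →ᵇ ℝ) (ψ : EllTwo) (n : ℤ) :
    schrodinger V ψ n = ψ (n - 1) + ψ (n + 1) + (V n : ℂ) * ψ n := rfl

theorem inner_translation (k : ℤ) (ψ φ : EllTwo) :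
    ⟪translation k ψ, φ⟫_ℂ = ⟪ψ, translation (-k) φ⟫_ℂ := by
  rw [lp.inner_eq_tsum, lp.inner_eq_tsum,
    ← (Equiv.addRight k).tsum_eq (fun n => ⟪ψ n, translation (-k) φ n⟫_ℂ)]
  refine tsum_congr fun n => ?_
  change ⟪ψ (n + k), φ n⟫_ℂ = ⟪ψ (n + k), φ (n + k + -k)⟫_ℂ
  rw [add_neg_cancel_right]

theorem inner_multiplication (V : ℤ →ᵇ ℝ) (ψ φ : EllTwo) :
    ⟪multiplication V ψ, φ⟫_ℂ = ⟪ψ, multiplication V φ⟫_ℂ := by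
  rw [lp.inner_eq_tsum, lp.inner_eq_tsum]
  refine tsum_congr fun n => ?_
  change ⟪(V n : ℂ) * ψ n, φ n⟫_ℂ = ⟪ψ n, (V n : ℂ) * φ n⟫_ℂ
  simp only [RCLike.inner_apply, map_mul, Complex.conj_ofReal]
  ring

theorem isSelfAdjoint_schrodinger (V : ℤ →ᵇ ℝ) : IsSelfAdjoint (schrodinger V) := by
  rw [ContinuousLinearMap.isSelfAdjoint_iff_isSymmetric]
  intro ψ φ
  change ⟪translation (-1) ψ + translation 1 ψ + multiplication V ψ, φ⟫_ℂ =
    ⟪ψ, translation (-1) φ + translation 1 φ + multiplication V φ⟫_ℂ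
  simp only [inner_add_left, inner_add_right, inner_translation, inner_multiplication, neg_neg]
  ring

/-! ### Spectra and spectral measures of bounded self-adjoint operators -/

section Spectral

variable {E : Type*} [NormedAddCommGroup E] [InnerProductSpace ℂ E] [CompleteSpace E]

/-- The spectrum of an operator as a set of real numbers. For a self-adjoint operator this is
the whole spectrum, see `image_realSpectrum`. -/
def realSpectrum (A : E →L[ℂ] E) : Set ℝ :=
  {x : ℝ | (x : ℂ) ∈ spectrum ℂ A}

theorem image_realSpectrum {A : E →L[ℂ] E} (hA : IsSelfAdjoint A) :
    Complex.ofReal '' realSpectrum A = spectrum ℂ A := by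
  ext z
  constructor
  · rintro ⟨x, hx, rfl⟩
    exact hx
  · intro hz
    have h : z = z.re := hA.mem_spectrum_eq_re hz
    exact ⟨z.re, show (z.re : ℂ) ∈ spectrum ℂ A from h ▸ hz, h.symm⟩

/-- The positive functional `g ↦ ⟪ψ, g(A) ψ⟫` on compactly supported continuous functions, where
`g(A)` is given by the continuous functional calculus. Meaningful for self-adjoint `A`; otherwise
the functional calculus, and hence the functional, is zero. -/
def spectralFunctional (A : E →L[ℂ] E) (ψ : E) : C_c(ℝ, ℝ) →ₚ[ℝ] ℝ :=
  PositiveLinearMap.mk₀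
    { toFun := fun g => (⟪ψ, cfc (⇑g) A ψ⟫_ℂ).re
      map_add' := fun g h => by
        have : cfc (⇑(g + h)) A = cfc (⇑g) A + cfc (⇑h) A :=
          cfc_add A g h g.continuous.continuousOn h.continuous.continuousOn
        rw [this, add_apply, inner_add_right, Complex.add_re]
      map_smul' := fun c g => by
        have : cfc (⇑(c • g)) A = c • cfc (⇑g) A :=
          cfc_smul c (⇑g) A g.continuous.continuousOn
        rw [this, smul_apply, ← Complex.coe_smul, inner_smul_right,
          Complex.re_ofReal_mul]
        rfl }
    (fun g hg => by
      have h : 0 ≤ cfc (⇑g) A := cfc_nonneg fun x _ => hg x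
      exact ((ContinuousLinearMap.nonneg_iff_isPositive _).mp h).re_inner_nonneg_right ψ)

/-- The spectral measure `μ_ψ` of the self-adjoint operator `A` and the vector `ψ`: the Borel
measure on `ℝ` with `∫ g dμ_ψ = ⟪ψ, g(A) ψ⟫`, obtained from the Riesz representation theorem. -/
def spectralMeasure (A : E →L[ℂ] E) (ψ : E) : Measure ℝ :=
  RealRMK.rieszMeasure (spectralFunctional A ψ)

/-- The operator `A` is self-adjoint and has purely singular continuous spectrum: every spectral
measure of `A` is free of atoms and singular with respect to Lebesgue measure. -/
def HasPurelySingularContinuousSpectrum (A : E →L[ℂ] E) : Prop :=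
  IsSelfAdjoint A ∧ ∀ ψ : E, (∀ x : ℝ, spectralMeasure A ψ {x} = 0) ∧
    spectralMeasure A ψ ⟂ₘ (volume : Measure ℝ)

end Spectral

/-- A Cantor set in `ℝ`: nonempty, compact, perfect and totally disconnected. -/
structure IsCantorSet (K : Set ℝ) : Prop where
  nonempty : K.Nonempty
  isCompact : IsCompact K
  perfect : Perfect K
  isTotallyDisconnected : IsTotallyDisconnected K

/-! ### Limit-periodic operators over a Cantor group -/

section CantorGroup

variable {Ω : Type*} [AddCommGroup Ω] [TopologicalSpace Ω] [CompactSpace Ω]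

/-- The potential `V_{ω,f}(n) = f(ω + nα)`. -/
def potential (α : Ω) (f : C(Ω, ℝ)) (ω : Ω) : ℤ →ᵇ ℝ :=
  (BoundedContinuousFunction.mkOfCompact f).compContinuous
    ⟨fun n : ℤ => ω + n • α, continuous_of_discreteTopology⟩

/-- The limit-periodic Schrödinger operator `H_{ω,f} = Δ + V_{ω,f}`. -/
def limitPeriodicOperator (α : Ω) (f : C(Ω, ℝ)) (ω : Ω) : EllTwo →L[ℂ] EllTwo :=
  schrodinger (potential α f ω)

end CantorGroup

end LimitPeriodic

end

noncomputable section

set_option linter.unusedSectionVars false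

namespace LimitPeriodic

/-! ### Self-adjoint operators -/

section Spectral

variable {E : Type*} [NormedAddCommGroup E] [InnerProductSpace ℂ E] [CompleteSpace E]
  {A : E →L[ℂ] E}

/-! Baire category. For each `k`, consider two properties of `f`, uniform in `ω`: the spectra are
covered by finitely many intervals of small total length (`HasThinSpectra`), and eigenvectors nearly
satisfy a three-term relation with some step `q ≥ k` (`IsGordonAt`). Both hold on a ball around
suitable periodic sampling functions, and these are dense (`exists_ball_hasThinSpectra`), so the
interiors form a countable family of dense open sets.

On the intersection the spectrum is null and there are no eigenvectors
(`volume_realSpectrum_eq_zero`, `eq_zero_of_isGordonAt`). Spectral measures live on the spectrum,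
hence are singular, and an atom would need an eigenvector. An isolated point of the spectrum would
be an eigenvalue, and a null set contains no interval, so the spectrum is a Cantor set.

The hard step is `exists_thin_spectrum`. A small periodic perturbation puts any prescribed energy in
a gap (`exists_gap_perturbation`), and by compactness finitely many perturbed potentials serve all
energies with one gap size. They are concatenated on long stretches within one huge period. For a
given energy, solutions decay inside the stretch where it is in a gap, so cutting the line in the
middle of that stretch costs exponentially little. The cut operator repeats one finite block, so it
has at most as many eigenvalues as the period. The spectrum thus lies exponentially close to a set
whose size is only linear in the stretch length. -/

theorem realSpectrum_eq_spectrum (A : E →L[ℂ] E) : realSpectrum A = spectrum ℝ A := by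
  ext x
  exact spectrum.algebraMap_mem_iff ℂ (r := x) (a := A)

/-- The operator `A - x` for real `x`. -/
def shifted (A : E →L[ℂ] E) (x : ℝ) : E →L[ℂ] E := A - algebraMap ℝ (E →L[ℂ] E) x

theorem shifted_apply (A : E →L[ℂ] E) (x : ℝ) (ψ : E) :
    shifted A x ψ = A ψ - (x : ℂ) • ψ := by
  simp [shifted, Algebra.algebraMap_eq_smul_one]

theorem isSelfAdjoint_shifted (hA : IsSelfAdjoint A) (x : ℝ) : IsSelfAdjoint (shifted A x) :=
  hA.sub (IsSelfAdjoint.algebraMap _ (IsSelfAdjoint.all x))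

theorem mem_realSpectrum_iff (A : E →L[ℂ] E) (x : ℝ) :
    x ∈ realSpectrum A ↔ ¬ IsUnit (shifted A x) := by
  rw [realSpectrum_eq_spectrum, spectrum.mem_iff, ← IsUnit.neg_iff, neg_sub]
  rfl

/-- The orthogonal complement of the range of a self-adjoint operator is its kernel. -/
theorem denseRange_shifted (hA : IsSelfAdjoint A) (x : ℝ)
    (h : ∀ ψ, shifted A x ψ = 0 → ψ = 0) : DenseRange (shifted A x) := by
  have h1 : (shifted A x).rangeᗮ = ⊥ := by
    rw [ContinuousLinearMap.orthogonal_range, (isSelfAdjoint_shifted hA x).adjoint_eq,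
      Submodule.eq_bot_iff]
    exact fun ψ hψ => h ψ hψ
  rw [← Submodule.topologicalClosure_eq_top_iff] at h1
  have h2 := congrArg (fun S : Submodule ℂ E => (S : Set E)) h1
  simp only [Submodule.topologicalClosure_coe, Submodule.top_coe] at h2
  exact dense_iff_closure_eq.mpr h2

theorem notMem_realSpectrum_of_bound (hA : IsSelfAdjoint A) {x c : ℝ} (hc : 0 < c)
    (h : ∀ ψ, c * ‖ψ‖ ≤ ‖shifted A x ψ‖) : x ∉ realSpectrum A := by
  rw [mem_realSpectrum_iff, not_not, ContinuousLinearMap.isUnit_iff_bijective,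
    ContinuousLinearMap.bijective_iff_dense_range_and_antilipschitz]
  constructor
  · have := denseRange_shifted hA x fun ψ hψ => by
      have := h ψ
      rw [hψ, norm_zero] at this
      exact norm_le_zero_iff.mp (nonpos_of_mul_nonpos_right this hc)
    have h2 := this.closure_range
    exact SetLike.coe_injective (by rw [Submodule.topologicalClosure_coe]; exact h2)
  · refine ⟨⟨c⁻¹, by positivity⟩, ContinuousLinearMap.antilipschitz_of_bound _ fun ψ => ?_⟩
    change ‖ψ‖ ≤ c⁻¹ * _
    rw [inv_mul_eq_div, le_div_iff₀ hc, mul_comm]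
    exact h ψ

theorem shifted_eq_cfc (hA : IsSelfAdjoint A) (x : ℝ) :
    shifted A x = cfc (fun t : ℝ => t - x) A := by
  rw [cfc_sub (fun t : ℝ => t) (fun _ => x) A, cfc_id' ℝ A, cfc_const x A]
  rfl

theorem bound_of_dist_spectrum (hA : IsSelfAdjoint A) {x c : ℝ} (hc : 0 < c)
    (h : ∀ y ∈ realSpectrum A, c ≤ |y - x|) (ψ : E) : c * ‖ψ‖ ≤ ‖shifted A x ψ‖ := by
  rw [realSpectrum_eq_spectrum] at h
  have hne : ∀ t ∈ spectrum ℝ A, t - x ≠ 0 := fun t ht h0 => by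
    have := h t ht
    rw [h0, abs_zero] at this
    linarith
  have hcont : ContinuousOn (fun t : ℝ => (t - x)⁻¹) (spectrum ℝ A) :=
    ContinuousOn.inv₀ (by fun_prop) hne
  have h1 : cfc (fun t : ℝ => (t - x)⁻¹) A * shifted A x = 1 := by
    rw [shifted_eq_cfc hA, ← cfc_mul _ _ A hcont (by fun_prop), ← cfc_const_one ℝ A]
    exact cfc_congr fun t ht => inv_mul_cancel₀ (hne t ht)
  have h2 : ‖cfc (fun t : ℝ => (t - x)⁻¹) A‖ ≤ c⁻¹ := by
    refine norm_cfc_le (by positivity) fun t ht => ?_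
    rw [norm_inv, Real.norm_eq_abs]
    exact inv_anti₀ hc (h t ht)
  have h3 : ψ = cfc (fun t : ℝ => (t - x)⁻¹) A (shifted A x ψ) :=
    (congrArg (fun T : E →L[ℂ] E => T ψ) h1).symm
  have h4 : ‖ψ‖ ≤ c⁻¹ * ‖shifted A x ψ‖ := by
    conv_lhs => rw [h3]
    exact ContinuousLinearMap.le_of_opNorm_le _ h2 _
  rwa [inv_mul_eq_div, le_div_iff₀ hc, mul_comm] at h4

/-- The tent function of height one and half-width `r` centred at `x`. -/
def tent (x r : ℝ) (hr : 0 < r) : C_c(ℝ, ℝ) where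
  toFun t := max 0 (1 - |t - x| / r)
  continuous_toFun := by fun_prop
  hasCompactSupport' := by
    refine HasCompactSupport.of_support_subset_isCompact (isCompact_closedBall x r) ?_
    intro t ht
    rw [Metric.mem_closedBall, Real.dist_eq]
    by_contra! hlt
    exact ht (max_eq_left (by
      rw [sub_nonpos, one_le_div hr]
      exact hlt.le))

theorem tent_apply (x r : ℝ) (hr : 0 < r) (t : ℝ) :
    tent x r hr t = max 0 (1 - |t - x| / r) := rfl

theorem tent_eq_zero {x r : ℝ} (hr : 0 < r) {t : ℝ} (h : r ≤ |t - x|) : tent x r hr t = 0 :=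
  max_eq_left (by rwa [sub_nonpos, one_le_div hr])

theorem tent_self (x r : ℝ) (hr : 0 < r) : tent x r hr x = 1 := by
  simp [tent_apply]

theorem tent_nonneg (x r : ℝ) (hr : 0 < r) (t : ℝ) : 0 ≤ tent x r hr t := le_max_left _ _

theorem tent_le_one (x r : ℝ) (hr : 0 < r) (t : ℝ) : tent x r hr t ≤ 1 := by
  rw [tent_apply]
  refine max_le zero_le_one ?_
  have : 0 ≤ |t - x| / r := by positivity
  linarith

theorem integral_spectralMeasure (A : E →L[ℂ] E) (ψ : E) (g : C_c(ℝ, ℝ)) :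
    ∫ t, g t ∂(spectralMeasure A ψ) = (⟪ψ, cfc (⇑g) A ψ⟫_ℂ).re :=
  RealRMK.integral_rieszMeasure (spectralFunctional A ψ) g

theorem spectralMeasure_le_of_one_le {ψ : E} {g : C_c(ℝ, ℝ)} (hg : ∀ t, 0 ≤ g t) {K : Set ℝ}
    (hK : MeasurableSet K) (hKg : ∀ t ∈ K, 1 ≤ g t) :
    spectralMeasure A ψ K ≤ ENNReal.ofReal (⟪ψ, cfc (⇑g) A ψ⟫_ℂ).re := by
  have hf : IsFiniteMeasureOnCompacts (spectralMeasure A ψ) := by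
    unfold spectralMeasure
    infer_instance
  rw [← integral_spectralMeasure, ofReal_integral_eq_lintegral_ofReal (f := fun t => g t)
    (g.continuous.integrable_of_hasCompactSupport g.hasCompactSupport)
    (Filter.Eventually.of_forall hg)]
  calc spectralMeasure A ψ K = ∫⁻ t, K.indicator 1 t ∂(spectralMeasure A ψ) := by
        rw [lintegral_indicator_one hK]
    _ ≤ _ := lintegral_mono fun t => by
        by_cases ht : t ∈ K
        · rw [Set.indicator_of_mem ht]
          simpa using hKg t ht
        · rw [Set.indicator_of_notMem ht]
          exact zero_le

/-- Since `A - x` has dense range, `ψ` is nearly `(A - x) η`. A tent `T` of width `r` at `x` has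
norm at most one and `T(A) (A - x)` has norm at most `r`, so `T(A) ψ` is small, and `⟪ψ, T(A) ψ⟫`
dominates the mass at `x`. -/
theorem spectralMeasure_singleton (hA : IsSelfAdjoint A) {x : ℝ}
    (h : ∀ ψ, shifted A x ψ = 0 → ψ = 0) (ψ : E) : spectralMeasure A ψ {x} = 0 := by
  have key : ∀ ε : ℝ, 0 < ε → spectralMeasure A ψ {x} ≤ ENNReal.ofReal ε := by
    intro ε hε
    obtain ⟨η, hη⟩ := (denseRange_shifted hA x h).exists_dist_lt ψ
      (show 0 < ε / (2 * (‖ψ‖ + 1)) by positivity)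
    rw [dist_eq_norm] at hη
    set r : ℝ := ε / (2 * (‖ψ‖ + 1) * (‖η‖ + 1)) with hrdef
    have hr : 0 < r := by positivity
    refine (spectralMeasure_le_of_one_le (g := tent x r hr) (tent_nonneg x r hr)
      (measurableSet_singleton x) (by rintro t rfl; exact (tent_self t r hr).ge)).trans
      (ENNReal.ofReal_le_ofReal ?_)
    set T := cfc (⇑(tent x r hr)) A with hT
    have hcont : Continuous (⇑(tent x r hr)) := (tent x r hr).continuous
    have h1 : ‖T‖ ≤ 1 := norm_cfc_le zero_le_one fun t _ => by
      rw [Real.norm_of_nonneg (tent_nonneg x r hr t)]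
      exact tent_le_one x r hr t
    have h2 : ‖T * shifted A x‖ ≤ r := by
      rw [hT, shifted_eq_cfc hA, ← cfc_mul _ _ A hcont.continuousOn (by fun_prop)]
      refine norm_cfc_le hr.le fun t _ => ?_
      rw [norm_mul, Real.norm_of_nonneg (tent_nonneg x r hr t), Real.norm_eq_abs]
      by_cases ht : r ≤ |t - x|
      · rw [tent_eq_zero hr ht, zero_mul]
        exact hr.le
      · calc _ ≤ 1 * |t - x| := by gcongr; exact tent_le_one x r hr t
          _ ≤ r := by linarith
    have h3 : T ψ = T (ψ - shifted A x η) + (T * shifted A x) η := by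
      rw [mul_apply_eq_comp, map_sub]
      abel
    have h4 : ‖T ψ‖ ≤ ε / (2 * (‖ψ‖ + 1)) + r * ‖η‖ := by
      rw [h3]
      refine (norm_add_le _ _).trans (add_le_add ?_ (ContinuousLinearMap.le_of_opNorm_le _ h2 _))
      refine (ContinuousLinearMap.le_of_opNorm_le _ h1 _).trans ?_
      rw [one_mul]
      exact hη.le
    have h5 : r * ‖η‖ ≤ ε / (2 * (‖ψ‖ + 1)) := by
      rw [hrdef, div_mul_eq_mul_div, div_le_div_iff₀ (by positivity) (by positivity)]
      have : 0 ≤ ε * (2 * (‖ψ‖ + 1)) := by positivity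
      nlinarith
    calc (⟪ψ, T ψ⟫_ℂ).re ≤ ‖⟪ψ, T ψ⟫_ℂ‖ := Complex.re_le_norm _
      _ ≤ ‖ψ‖ * ‖T ψ‖ := norm_inner_le_norm _ _
      _ ≤ (‖ψ‖ + 1) * (ε / (2 * (‖ψ‖ + 1)) + ε / (2 * (‖ψ‖ + 1))) := by
        gcongr
        · linarith
        · linarith
      _ = ε := by field_simp; ring
  refine le_antisymm (ENNReal.le_of_forall_pos_le_add fun ε hε _ => ?_) zero_le
  rw [zero_add]
  exact (key ε hε).trans (by simp)

theorem isCompact_realSpectrum (A : E →L[ℂ] E) : IsCompact (realSpectrum A) := by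
  rw [realSpectrum_eq_spectrum]
  exact spectrum.isCompact A

theorem spectralMeasure_compl_realSpectrum (A : E →L[ℂ] E) (ψ : E) :
    spectralMeasure A ψ (realSpectrum A)ᶜ = 0 := by
  refine measure_null_of_locally_null _ fun x hx => ?_
  have hopen : IsOpen (realSpectrum A)ᶜ := (isCompact_realSpectrum A).isClosed.isOpen_compl
  obtain ⟨r, hr, hball⟩ := Metric.isOpen_iff.mp hopen x hx
  refine ⟨Metric.ball x (r / 2), mem_nhdsWithin_of_mem_nhds (Metric.ball_mem_nhds _ (by positivity)),
    le_antisymm ?_ zero_le⟩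
  -- The factor 2 lifts the tent above one on the ball of half the radius; it still vanishes on the
  -- spectrum.
  refine (spectralMeasure_le_of_one_le (g := (2 : ℝ) • tent x r hr)
    (fun t => mul_nonneg zero_le_two (tent_nonneg x r hr t)) measurableSet_ball
    fun t ht => ?_).trans ?_
  · rw [Metric.mem_ball, Real.dist_eq] at ht
    change 1 ≤ 2 * tent x r hr t
    have : |t - x| / r ≤ 1 / 2 := by
      rw [div_le_iff₀ hr]
      linarith
    have h2 : 1 - |t - x| / r ≤ tent x r hr t := le_max_right _ _
    linarith
  · have : cfc (⇑((2 : ℝ) • tent x r hr)) A = 0 := by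
      rw [← cfc_const_zero ℝ A]
      refine cfc_congr fun t ht => ?_
      change 2 * tent x r hr t = 0
      rw [tent_eq_zero hr, mul_zero]
      by_contra! hlt
      rw [← realSpectrum_eq_spectrum] at ht
      exact hball (by rwa [Metric.mem_ball, Real.dist_eq]) ht
    rw [this]
    simp

/-- At an isolated point `x`, a narrow tent gives a nonzero operator `T(A)` with `(A - x) T(A) = 0`,
so its range would contain an eigenvector. -/
theorem perfect_realSpectrum (hA : IsSelfAdjoint A)
    (h : ∀ x ψ, shifted A x ψ = 0 → ψ = 0) : Perfect (realSpectrum A) := by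
  refine ⟨(isCompact_realSpectrum A).isClosed, fun x hx => ?_⟩
  rw [accPt_iff_nhds]
  intro U hU
  by_contra! hcon
  obtain ⟨r, hr, hball⟩ := Metric.mem_nhds_iff.mp hU
  have hiso : ∀ t ∈ spectrum ℝ A, t ≠ x → r ≤ |t - x| := fun t ht hne => by
    by_contra! hlt
    exact hne (hcon t ⟨hball (by rwa [Metric.mem_ball, Real.dist_eq]),
      by rwa [realSpectrum_eq_spectrum]⟩)
  have hcont : Continuous (⇑(tent x r hr)) := (tent x r hr).continuous
  have hzero : shifted A x * cfc (⇑(tent x r hr)) A = 0 := by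
    rw [shifted_eq_cfc hA, ← cfc_mul _ _ A (by fun_prop) hcont.continuousOn,
      ← cfc_const_zero ℝ A]
    refine cfc_congr fun t ht => ?_
    by_cases htx : t = x
    · simp [htx]
    · change (t - x) * tent x r hr t = 0
      rw [tent_eq_zero hr (hiso t ht htx), mul_zero]
  have hT : cfc (⇑(tent x r hr)) A = 0 := by
    ext ψ
    exact h x _ (congrArg (fun T : E →L[ℂ] E => T ψ) hzero)
  rw [realSpectrum_eq_spectrum] at hx
  have := norm_apply_le_norm_cfc (⇑(tent x r hr)) A hx hcont.continuousOn
  rw [hT, tent_self] at this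
  norm_num at this

theorem isTotallyDisconnected_of_volume_eq_zero {K : Set ℝ} (hK : volume K = 0) :
    IsTotallyDisconnected K := by
  intro t htK ht a ha b hb
  by_contra hne
  wlog hab : a < b generalizing a b
  · exact this hb ha (Ne.symm hne) (lt_of_le_of_ne (not_lt.mp hab) (Ne.symm hne))
  have h1 : Set.Icc a b ⊆ K := (ht.ordConnected.out ha hb).trans htK
  have h2 := measure_mono_null h1 hK
  rw [Real.volume_Icc, ENNReal.ofReal_eq_zero] at h2
  linarith

theorem isCantorSet_realSpectrum [Nontrivial E] (hA : IsSelfAdjoint A)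
    (hvol : volume (realSpectrum A) = 0)
    (h : ∀ x ψ, shifted A x ψ = 0 → ψ = 0) : IsCantorSet (realSpectrum A) where
  nonempty := by
    obtain ⟨z, hz⟩ := (spectrum.nonempty A : (spectrum ℂ A).Nonempty)
    rw [← image_realSpectrum hA] at hz
    obtain ⟨x, hx, -⟩ := hz
    exact ⟨x, hx⟩
  isCompact := isCompact_realSpectrum A
  perfect := perfect_realSpectrum hA h
  isTotallyDisconnected := isTotallyDisconnected_of_volume_eq_zero hvol

theorem hasPurelySingularContinuousSpectrum (hA : IsSelfAdjoint A)
    (hvol : volume (realSpectrum A) = 0)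
    (h : ∀ x ψ, shifted A x ψ = 0 → ψ = 0) : HasPurelySingularContinuousSpectrum A :=
  ⟨hA, fun ψ => ⟨fun x => spectralMeasure_singleton hA (h x) ψ,
    (realSpectrum A)ᶜ, (isCompact_realSpectrum A).isClosed.isOpen_compl.measurableSet,
    spectralMeasure_compl_realSpectrum A ψ, by rwa [compl_compl]⟩⟩

end Spectral

/-! ### Bounds in `ℓ²(ℤ)` -/

/-- The sequence `u` is square summable with `ℓ²`-norm at most `c`. -/
def L2Le (u : ℤ → ℂ) (c : ℝ) : Prop := ∃ U : EllTwo, (∀ n, U n = u n) ∧ ‖U‖ ≤ c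

theorem L2Le.nonneg {u : ℤ → ℂ} {c : ℝ} (h : L2Le u c) : 0 ≤ c := by
  obtain ⟨U, -, hU⟩ := h
  exact (norm_nonneg U).trans hU

theorem L2Le.mono {u : ℤ → ℂ} {c d : ℝ} (h : L2Le u c) (hcd : c ≤ d) : L2Le u d := by
  obtain ⟨U, hu, hU⟩ := h
  exact ⟨U, hu, hU.trans hcd⟩

theorem L2Le.of_coe (ψ : EllTwo) : L2Le ψ ‖ψ‖ := ⟨ψ, fun _ => rfl, le_rfl⟩

theorem L2Le.norm_le {ψ : EllTwo} {c : ℝ} (h : L2Le ψ c) : ‖ψ‖ ≤ c := by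
  obtain ⟨U, hu, hU⟩ := h
  rwa [show U = ψ from lp.ext (funext hu)] at hU

theorem L2Le.zero : L2Le (fun _ => 0) 0 := ⟨0, fun _ => rfl, by simp⟩

theorem L2Le.add {u v : ℤ → ℂ} {c d : ℝ} (hu : L2Le u c) (hv : L2Le v d) :
    L2Le (fun n => u n + v n) (c + d) := by
  obtain ⟨U, hu, hU⟩ := hu
  obtain ⟨V, hv, hV⟩ := hv
  exact ⟨U + V, fun n => congrArg₂ (· + ·) (hu n) (hv n), (norm_add_le _ _).trans (add_le_add hU hV)⟩

theorem L2Le.sub {u v : ℤ → ℂ} {c d : ℝ} (hu : L2Le u c) (hv : L2Le v d) :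
    L2Le (fun n => u n - v n) (c + d) := by
  obtain ⟨U, hu, hU⟩ := hu
  obtain ⟨V, hv, hV⟩ := hv
  exact ⟨U - V, fun n => congrArg₂ (· - ·) (hu n) (hv n), (norm_sub_le _ _).trans (add_le_add hU hV)⟩

theorem L2Le.shift {u : ℤ → ℂ} {c : ℝ} (hu : L2Le u c) (k : ℤ) :
    L2Le (fun n => u (n + k)) c := by
  obtain ⟨U, hu, hU⟩ := hu
  refine ⟨translation k U, fun n => hu (n + k), ?_⟩
  refine (ContinuousLinearMap.le_of_opNorm_le _ (LinearMap.mkContinuous_norm_le _ zero_le_one _)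
    U).trans ?_
  rwa [one_mul]

theorem L2Le.of_norm_le {u v : ℤ → ℂ} {c K : ℝ} (hu : L2Le u c) (hK : 0 ≤ K)
    (h : ∀ n, ‖v n‖ ≤ K * ‖u n‖) : L2Le v (K * c) := by
  obtain ⟨U, hu, hU⟩ := hu
  have h' : ∀ n, ‖v n‖ ≤ ‖((K : ℂ) • U) n‖ := fun n => by
    rw [lp.coeFn_smul, Pi.smul_apply, norm_smul, Complex.norm_real, Real.norm_of_nonneg hK, hu]
    exact h n
  refine ⟨⟨v, (lp.memℓp ((K : ℂ) • U)).mono' h'⟩, fun _ => rfl, ?_⟩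
  refine (lp.norm_mono (by norm_num) h').trans ?_
  rw [norm_smul, Complex.norm_real, Real.norm_of_nonneg hK]
  gcongr

theorem L2Le.mul_left {u : ℤ → ℂ} {c K : ℝ} (hu : L2Le u c) (hK : 0 ≤ K) {m : ℤ → ℝ}
    (hm : ∀ n, |m n| ≤ K) : L2Le (fun n => (m n : ℂ) * u n) (K * c) :=
  hu.of_norm_le hK fun n => by
    rw [norm_mul, Complex.norm_real, Real.norm_eq_abs]
    exact mul_le_mul_of_nonneg_right (hm n) (norm_nonneg _)

theorem L2Le.norm_apply_le {u : ℤ → ℂ} {c : ℝ} (hu : L2Le u c) (n : ℤ) : ‖u n‖ ≤ c := by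
  obtain ⟨U, hu, hU⟩ := hu
  rw [← hu]
  exact (lp.norm_apply_le_norm (by norm_num) U n).trans hU

/-- The sequence `(Δ - x) ψ`. With `x = E - V` this is `(H - E) ψ` for `H = Δ + V`. -/
def residual (x : ℤ → ℝ) (ψ : ℤ → ℂ) (n : ℤ) : ℂ := ψ (n - 1) + ψ (n + 1) - (x n : ℂ) * ψ n

/-- The operator `Δ - x` is bounded below by `η`. -/
def BoundedBelow (x : ℤ → ℝ) (η : ℝ) : Prop :=
  ∀ (ψ : EllTwo) (c : ℝ), L2Le (residual x ψ) c → η * ‖ψ‖ ≤ c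

theorem BoundedBelow.perturb {x y : ℤ → ℝ} {η ε : ℝ} (h : BoundedBelow x η) (hε : 0 ≤ ε)
    (hxy : ∀ n, |x n - y n| ≤ ε) : BoundedBelow y (η - ε) := by
  intro ψ c hc
  have := h ψ (c + ε * ‖ψ‖) (by
    convert hc.sub ((L2Le.of_coe ψ).mul_left hε hxy) using 1
    funext n
    simp only [residual]
    push_cast
    ring)
  linarith

theorem BoundedBelow.shift {x : ℤ → ℝ} {η : ℝ} (h : BoundedBelow x η) (k : ℤ) :
    BoundedBelow (fun n => x (n + k)) η := by
  intro ψ c hc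
  have h1 := h (translation (-k) ψ) c (by
    convert hc.shift (-k) using 1
    funext n
    simp only [residual]
    change ψ (n - 1 + -k) + ψ (n + 1 + -k) - x n * ψ (n + -k) = _
    rw [show n + -k + k = n by ring, show n - 1 + -k = n + -k - 1 by ring,
      show n + 1 + -k = n + -k + 1 by ring])
  have h2 : ‖ψ‖ ≤ ‖translation (-k) ψ‖ := by
    refine L2Le.norm_le ?_
    convert (L2Le.of_coe (translation (-k) ψ)).shift k using 1
    funext n
    change ψ n = ψ (n + k + -k)
    rw [add_neg_cancel_right]
  by_cases hη : 0 ≤ η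
  · exact (mul_le_mul_of_nonneg_left h2 hη).trans h1
  · exact (mul_nonpos_of_nonpos_of_nonneg (not_le.mp hη).le (norm_nonneg _)).trans hc.nonneg

/-- The hopping part has norm at most 2, so a diagonal part of modulus at least 3 dominates it by 1.
-/
theorem boundedBelow_of_large {x : ℤ → ℝ} (hx : ∀ n, 3 ≤ |x n|) :
    BoundedBelow x 1 := by
  intro ψ c hc
  have h1 : L2Le (fun n => (x n : ℂ) * ψ n) (‖ψ‖ + ‖ψ‖ + c) := by
    convert (((L2Le.of_coe ψ).shift (-1)).add ((L2Le.of_coe ψ).shift 1)).sub hc using 1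
    funext n
    simp only [residual]
    rw [← sub_eq_add_neg]
    ring
  have h2 : ‖ψ‖ ≤ 3⁻¹ * (‖ψ‖ + ‖ψ‖ + c) := by
    refine L2Le.norm_le (h1.of_norm_le (by norm_num) fun n => ?_)
    rw [norm_mul, Complex.norm_real, Real.norm_eq_abs]
    have := mul_le_mul_of_nonneg_right (hx n) (norm_nonneg (ψ n))
    nlinarith [norm_nonneg (ψ n)]
  linarith

/-! ### Transfer matrices -/

/-- The one-step transfer matrix. -/
def stepMatrix (y : ℝ) : Matrix (Fin 2) (Fin 2) ℝ := !![y, -1; 1, 0]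

/-- The transfer matrix over the sites `n, …, n + k - 1`. -/
def transferMatrix (x : ℤ → ℝ) : ℕ → ℤ → Matrix (Fin 2) (Fin 2) ℝ
  | 0, _ => 1
  | k + 1, n => stepMatrix (x (n + k)) * transferMatrix x k n

theorem transferMatrix_zero (x : ℤ → ℝ) (n : ℤ) : transferMatrix x 0 n = 1 := rfl

theorem transferMatrix_succ (x : ℤ → ℝ) (k : ℕ) (n : ℤ) :
    transferMatrix x (k + 1) n = stepMatrix (x (n + k)) * transferMatrix x k n := rfl

theorem det_stepMatrix (y : ℝ) : (stepMatrix y).det = 1 := by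
  simp [stepMatrix, Matrix.det_fin_two]

theorem det_transferMatrix (x : ℤ → ℝ) (k : ℕ) (n : ℤ) : (transferMatrix x k n).det = 1 := by
  induction k with
  | zero => simp [transferMatrix_zero]
  | succ k ih => rw [transferMatrix_succ, Matrix.det_mul, det_stepMatrix, ih, one_mul]

theorem transferMatrix_add (x : ℤ → ℝ) (k l : ℕ) (n : ℤ) :
    transferMatrix x (k + l) n = transferMatrix x l (n + k) * transferMatrix x k n := by
  induction l with
  | zero => simp [transferMatrix_zero]
  | succ l ih =>
    rw [← add_assoc, transferMatrix_succ, ih, transferMatrix_succ, Matrix.mul_assoc]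
    push_cast
    rw [add_assoc]

theorem transferMatrix_one (x : ℤ → ℝ) (n : ℤ) : transferMatrix x 1 n = stepMatrix (x n) := by
  rw [transferMatrix_succ, transferMatrix_zero, Matrix.mul_one]
  simp

theorem transferMatrix_congr {x y : ℤ → ℝ} {k : ℕ} {n m : ℤ}
    (h : ∀ i : ℕ, i < k → x (n + i) = y (m + i)) :
    transferMatrix x k n = transferMatrix y k m := by
  induction k with
  | zero => rfl
  | succ k ih =>
    rw [transferMatrix_succ, transferMatrix_succ, h k (Nat.lt_succ_self k),
      ih fun i hi => h i (Nat.lt_succ_of_lt hi)]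

theorem transferMatrix_period {x : ℤ → ℝ} {q : ℕ} (hx : ∀ n, x (n + q) = x n) (k : ℕ) (n : ℤ) :
    transferMatrix x k (n + q) = transferMatrix x k n :=
  transferMatrix_congr fun i _ => by rw [add_right_comm, hx]

theorem trace_transferMatrix_succ {x : ℤ → ℝ} {q : ℕ} (hx : ∀ n, x (n + q) = x n) (n : ℤ) :
    (transferMatrix x q (n + 1)).trace = (transferMatrix x q n).trace := by
  have h1 : stepMatrix (x n) * transferMatrix x q n
      = transferMatrix x q (n + 1) * stepMatrix (x n) := by
    rw [← hx n, ← transferMatrix_succ, add_comm q 1, transferMatrix_add, transferMatrix_one, hx n]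
    simp
  have h2 : IsUnit (stepMatrix (x n)).det := by rw [det_stepMatrix]; exact isUnit_one
  rw [← Matrix.mul_nonsing_inv_cancel_right (stepMatrix (x n)) (transferMatrix x q (n + 1)) h2,
    ← h1, Matrix.trace_mul_cycle, Matrix.nonsing_inv_mul _ h2, Matrix.one_mul]

theorem trace_transferMatrix {x : ℤ → ℝ} {q : ℕ} (hx : ∀ n, x (n + q) = x n) (n : ℤ) :
    (transferMatrix x q n).trace = (transferMatrix x q 0).trace := by
  induction n using Int.induction_on with
  | zero => rfl
  | succ n ih => rw [trace_transferMatrix_succ hx, ih]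
  | pred n ih => rw [← trace_transferMatrix_succ hx, sub_add_cancel, ih]

theorem abs_transferMatrix_le {x : ℤ → ℝ} {B : ℝ} (hB : 0 ≤ B) (hx : ∀ n, |x n| ≤ B)
    (k : ℕ) (n : ℤ) (i j : Fin 2) : |transferMatrix x k n i j| ≤ (B + 1) ^ k := by
  induction k generalizing i with
  | zero => fin_cases i <;> fin_cases j <;> simp [transferMatrix_zero]
  | succ k ih =>
    have hpow : 0 ≤ (B + 1) ^ k := by positivity
    rw [transferMatrix_succ, Matrix.mul_apply, Fin.sum_univ_two, pow_succ]
    fin_cases i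
    · simp only [stepMatrix, Fin.zero_eta, Matrix.of_apply, Matrix.cons_val_zero,
        Matrix.cons_val_one, Matrix.cons_val', Matrix.cons_val_fin_one]
      calc _ ≤ |x (n + k) * transferMatrix x k n 0 j| + |-1 * transferMatrix x k n 1 j| :=
            abs_add_le _ _
        _ ≤ B * (B + 1) ^ k + 1 * (B + 1) ^ k := by
            rw [abs_mul, abs_mul, abs_neg, abs_one]
            gcongr
            · exact hx _
            · exact ih 0
            · exact ih 1
        _ = _ := by ring
    · simp only [stepMatrix, Fin.mk_one, Matrix.of_apply, Matrix.cons_val_zero,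
        Matrix.cons_val_one, Matrix.cons_val', Matrix.cons_val_fin_one, zero_mul, add_zero,
        one_mul]
      exact (ih 0).trans (by nlinarith)

/-- Approximate solutions follow the transfer matrices up to an `ℓ²` error. What matters is that `C`
depends only on `B` and `k`, not on `x` or `ψ`. -/
theorem transferMatrix_remainder {B : ℝ} (hB : 0 ≤ B) (k : ℕ) :
    ∃ C : ℝ, 0 ≤ C ∧ ∀ x : ℤ → ℝ, (∀ n, |x n| ≤ B) → ∀ (ψ : EllTwo) (c : ℝ),
      L2Le (residual x ψ) c →
      L2Le (fun n => ψ (n + k) - ((transferMatrix x k n 0 0 : ℝ) : ℂ) * ψ n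
        - ((transferMatrix x k n 0 1 : ℝ) : ℂ) * ψ (n - 1)) (C * c) ∧
      L2Le (fun n => ψ (n + k - 1) - ((transferMatrix x k n 1 0 : ℝ) : ℂ) * ψ n
        - ((transferMatrix x k n 1 1 : ℝ) : ℂ) * ψ (n - 1)) (C * c) := by
  induction k with
  | zero =>
    refine ⟨0, le_rfl, fun x _ ψ c _ => ?_⟩
    rw [zero_mul]
    constructor <;> convert L2Le.zero using 1 <;> funext n <;> simp [transferMatrix_zero]
  | succ k ih =>
    obtain ⟨C, hC, h⟩ := ih
    refine ⟨(B + 1) * C + 1, by positivity, fun x hx ψ c hc => ?_⟩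
    obtain ⟨h0, h1⟩ := h x hx ψ c hc
    have hc0 := hc.nonneg
    have hstep : ∀ n j, transferMatrix x (k + 1) n 0 j
        = x (n + k) * transferMatrix x k n 0 j - transferMatrix x k n 1 j ∧
        transferMatrix x (k + 1) n 1 j = transferMatrix x k n 0 j := fun n j => by
      rw [transferMatrix_succ]
      simp [Matrix.mul_apply, Fin.sum_univ_two, stepMatrix, sub_eq_add_neg]
    constructor
    · refine L2Le.mono (c := B * (C * c) + C * c + c) ?_ (by nlinarith)
      convert ((h0.mul_left hB (m := fun n => x (n + k)) fun n => hx _).sub h1).add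
        (hc.shift k) using 1
      funext n
      rw [(hstep n 0).1, (hstep n 1).1]
      simp only [residual]
      push_cast
      rw [← add_assoc]
      ring
    · refine L2Le.mono (c := C * c) ?_ (by nlinarith [mul_nonneg hB (mul_nonneg hC hc0)])
      convert h0 using 1
      funext n
      rw [(hstep n 0).2, (hstep n 1).2]
      push_cast
      rw [← add_assoc, add_sub_cancel_right]

/-- For a `q`-periodic sequence `x`, the operator `S^q + S^{-q} - tr M` factors through `Δ - x`,
where `M` is the monodromy matrix. -/
theorem discriminant_bound {B : ℝ} (hB : 0 ≤ B) (q : ℕ) :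
    ∃ C : ℝ, 0 ≤ C ∧ ∀ x : ℤ → ℝ, (∀ n, |x n| ≤ B) → (∀ n, x (n + q) = x n) →
      ∀ (ψ : EllTwo) (c : ℝ), L2Le (residual x ψ) c →
      L2Le (fun n => ψ (n + q) + ψ (n - q) - (((transferMatrix x q 0).trace : ℝ) : ℂ) * ψ n)
        (C * c) := by
  obtain ⟨C, hC, h⟩ := transferMatrix_remainder hB q
  refine ⟨C + (B + 1) ^ q * C + (B + 1) ^ q * C, by positivity, fun x hx hper ψ c hc => ?_⟩
  obtain ⟨h0, h1⟩ := h x hx ψ c hc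
  have hK : (0 : ℝ) ≤ (B + 1) ^ q := by positivity
  -- Eliminating `ψ (n - 1)` and `ψ (n - q - 1)` between the relations at `n` and `n - q` leaves the
  -- trace in front of `ψ n` and the determinant, which is 1, in front of `ψ (n - q)`.
  have key := (h0.sub ((h0.shift (-q)).mul_left hK fun n => abs_transferMatrix_le hB hx q n 1 1)).add
    ((h1.shift (-q)).mul_left hK fun n => abs_transferMatrix_le hB hx q n 0 1)
  convert key using 1
  · funext n
    have hM : transferMatrix x q (n + -q) = transferMatrix x q n := by
      rw [← transferMatrix_period hper q (n + -q), neg_add_cancel_right]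
    have hdet := det_transferMatrix x q n
    rw [Matrix.det_fin_two] at hdet
    have hdet' : ((transferMatrix x q n 0 0 : ℝ) : ℂ) * (transferMatrix x q n 1 1 : ℝ)
        - (transferMatrix x q n 0 1 : ℝ) * (transferMatrix x q n 1 0 : ℝ) = 1 := by
      exact_mod_cast hdet
    rw [hM, ← trace_transferMatrix hper n, Matrix.trace_fin_two, neg_add_cancel_right,
      ← sub_eq_add_neg]
    push_cast
    linear_combination (-ψ (n - q)) * hdet'
  · ring

/-- `S^q + S^{-q}` has norm at most 2, so subtracting a scalar of modulus above 2 leaves an operator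
bounded below; `discriminant_bound` transfers this to `Δ - x`. -/
theorem boundedBelow_of_two_lt_abs_trace {x : ℤ → ℝ} {B : ℝ} (hB : 0 ≤ B) (hx : ∀ n, |x n| ≤ B)
    {q : ℕ} (hper : ∀ n, x (n + q) = x n) (htr : 2 < |(transferMatrix x q 0).trace|) :
    ∃ η > 0, BoundedBelow x η := by
  obtain ⟨C, hC, h⟩ := discriminant_bound hB q
  set D := (transferMatrix x q 0).trace with hD
  refine ⟨(|D| - 2) / (C + 1), div_pos (by linarith) (by positivity), fun ψ c hc => ?_⟩
  have h1 := h x hx hper ψ c hc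
  have h2 : L2Le (fun n => (D : ℂ) * ψ n) (‖ψ‖ + ‖ψ‖ + C * c) := by
    convert (((L2Le.of_coe ψ).shift q).add ((L2Le.of_coe ψ).shift (-q))).sub h1 using 1
    funext n
    rw [← sub_eq_add_neg]
    ring
  have hD0 : 0 < |D| := by linarith
  have h3 : ‖ψ‖ ≤ |D|⁻¹ * (‖ψ‖ + ‖ψ‖ + C * c) := by
    refine L2Le.norm_le (h2.of_norm_le (by positivity) fun n => ?_)
    rw [norm_mul, Complex.norm_real, Real.norm_eq_abs, inv_mul_cancel_left₀ hD0.ne']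
  rw [inv_mul_eq_div, le_div_iff₀ hD0] at h3
  rw [div_mul_eq_mul_div, div_le_iff₀ (by positivity)]
  have := hc.nonneg
  nlinarith

/-! ### Opening a gap at a given energy -/

theorem periodic_mul {x : ℤ → ℝ} {q : ℕ} (hx : ∀ n, x (n + q) = x n) (m : ℕ) (n : ℤ) :
    x (n + (q * m : ℕ)) = x n := by
  induction m with
  | zero => simp
  | succ m ih =>
    rw [← ih, ← hx (n + (q * m : ℕ))]
    congr 1
    push_cast
    ring

theorem periodic_of_dvd {x : ℤ → ℝ} {q N : ℕ} (hx : ∀ n, x (n + q) = x n) (h : q ∣ N) (n : ℤ) :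
    x (n + N) = x n := by
  obtain ⟨m, rfl⟩ := h
  exact periodic_mul hx m n

theorem periodic_emod {x : ℤ → ℝ} {q : ℕ} (hx : ∀ n, x (n + q) = x n) (n : ℤ) :
    x (n % q) = x n := by
  have h : Function.Periodic x (q : ℤ) := hx
  rw [Int.emod_def, mul_comm, ← smul_eq_mul, h.sub_zsmul_eq]

theorem exists_bound_of_periodic {x : ℤ → ℝ} {q : ℕ} (hq : 0 < q) (hx : ∀ n, x (n + q) = x n) :
    ∃ B, 0 ≤ B ∧ ∀ n, |x n| ≤ B := by
  refine ⟨∑ i ∈ Finset.range q, |x i|, by positivity, fun n => ?_⟩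
  have h0 : 0 ≤ n % q := Int.emod_nonneg _ (by positivity)
  have h1 : n % q < q := Int.emod_lt_of_pos _ (by positivity)
  obtain ⟨i, hi⟩ := Int.eq_ofNat_of_zero_le h0
  rw [← periodic_emod hx n, hi]
  exact Finset.single_le_sum (f := fun i : ℕ => |x i|) (fun _ _ => abs_nonneg _)
    (Finset.mem_range.mpr (by omega))

/-- Perturbation of a sequence at the sites congruent to `0` and `1` modulo `q`. -/
def perturb (x : ℤ → ℝ) (q : ℕ) (s t : ℝ) (n : ℤ) : ℝ :=
  x n + if n % q = 0 then s else if n % q = 1 then t else 0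

theorem perturb_periodic {x : ℤ → ℝ} {q : ℕ} (hx : ∀ n, x (n + q) = x n) (s t : ℝ) (n : ℤ) :
    perturb x q s t (n + q) = perturb x q s t n := by
  simp [perturb, hx]

theorem abs_perturb_sub_le (x : ℤ → ℝ) (q : ℕ) {s t ε : ℝ} (hs : |s| ≤ ε) (ht : |t| ≤ ε)
    (n : ℤ) : |perturb x q s t n - x n| ≤ ε := by
  have : 0 ≤ ε := (abs_nonneg s).trans hs
  unfold perturb
  split_ifs <;> simpa

theorem transferMatrix_split (x : ℤ → ℝ) {q : ℕ} (hq : 2 ≤ q) :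
    transferMatrix x q 0 =
      transferMatrix x (q - 2) 2 * (stepMatrix (x 1) * stepMatrix (x 0)) := by
  obtain ⟨k, rfl⟩ := Nat.exists_eq_add_of_le hq
  rw [transferMatrix_add]
  simp [transferMatrix_succ, transferMatrix_zero]

theorem transferMatrix_perturb (x : ℤ → ℝ) {q : ℕ} (hq : 2 ≤ q) (s t : ℝ) :
    transferMatrix (perturb x q s t) q 0 =
      transferMatrix x (q - 2) 2 * (stepMatrix (x 1 + t) * stepMatrix (x 0 + s)) := by
  have h1 : (1 : ℤ) % q = 1 := Int.emod_eq_of_lt (by norm_num) (by omega)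
  rw [transferMatrix_split _ hq]
  congr 1
  · refine transferMatrix_congr fun i hi => ?_
    have : (2 + (i : ℤ)) % q = 2 + i := Int.emod_eq_of_lt (by omega) (by omega)
    rw [perturb, this, if_neg (by omega), if_neg (by omega), add_zero]
  · simp [perturb, h1]

theorem trace_mul_stepMatrix (N : Matrix (Fin 2) (Fin 2) ℝ) (a b : ℝ) :
    (N * (stepMatrix b * stepMatrix a)).trace
      = N 0 0 * (b * a - 1) + N 0 1 * a - N 1 0 * b - N 1 1 := by
  simp [Matrix.trace_fin_two, Matrix.mul_apply, Fin.sum_univ_two, stepMatrix]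
  ring

/-- At a closed gap, where the monodromy is `±1`, opposite shifts at two adjacent sites push the
trace strictly beyond 2 in modulus. -/
theorem trace_mul_stepMatrix_of_eq_smul_one {N : Matrix (Fin 2) (Fin 2) ℝ} {a b c : ℝ}
    (h : N * (stepMatrix b * stepMatrix a) = c • (1 : Matrix (Fin 2) (Fin 2) ℝ)) (s : ℝ) :
    (N * (stepMatrix (b + -s) * stepMatrix (a + s))).trace = c * (2 + s ^ 2) := by
  have h00 := congrFun (congrFun h 0) 0
  have h01 := congrFun (congrFun h 0) 1
  have h10 := congrFun (congrFun h 1) 0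
  have h11 := congrFun (congrFun h 1) 1
  simp [Matrix.mul_apply, Fin.sum_univ_two, stepMatrix] at h00 h01 h10 h11
  have e00 : N 0 0 = -c := by linear_combination (-1) * h00 - a * h01
  have e01 : N 0 1 = c * b := by linear_combination (-b) * e00 - h01
  have e10 : N 1 0 = -(c * a) := by linear_combination (-1) * h10 - a * h11
  have e11 : N 1 1 = c * (a * b) - c := by linear_combination (-b) * e10 - h11
  rw [trace_mul_stepMatrix, e00, e01, e10, e11]
  ring

/-- The trace of the monodromy matrix is not locally constant under perturbation at two sites. -/
theorem exists_trace_ne {N : Matrix (Fin 2) (Fin 2) ℝ} (hN : N.det = 1) (a b : ℝ) {ε : ℝ}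
    (hε : 0 < ε) : ∃ s t : ℝ, |s| ≤ ε ∧ |t| ≤ ε ∧
      (N * (stepMatrix (b + t) * stepMatrix (a + s))).trace
        ≠ (N * (stepMatrix b * stepMatrix a)).trace := by
  by_contra! hcon
  have hε' : |ε| ≤ ε := (abs_of_pos hε).le
  have h0 : |(0 : ℝ)| ≤ ε := by simpa using hε.le
  have h1 := hcon ε 0 hε' h0
  have h2 := hcon 0 ε h0 hε'
  have h3 := hcon ε ε hε' hε'
  rw [trace_mul_stepMatrix, trace_mul_stepMatrix] at h1 h2 h3
  -- The trace is affine in each of `s` and `t`. Constancy at the corners of a square forces its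
  -- non-constant coefficients to vanish, hence `N 0 0 = N 0 1 = 0`, contradicting determinant one.
  have e1 : N 0 0 * b + N 0 1 = 0 := by
    have : ε * (N 0 0 * b + N 0 1) = 0 := by linear_combination h1
    exact (mul_eq_zero.mp this).resolve_left hε.ne'
  have e2 : N 0 0 * a - N 1 0 = 0 := by
    have : ε * (N 0 0 * a - N 1 0) = 0 := by linear_combination h2
    exact (mul_eq_zero.mp this).resolve_left hε.ne'
  have e3 : N 0 0 = 0 := by
    have : ε * ε * N 0 0 = 0 := by linear_combination h3 - ε * e1 - ε * e2
    exact (mul_eq_zero.mp this).resolve_left (mul_ne_zero hε.ne' hε.ne')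
  rw [e3, zero_mul, zero_add] at e1
  rw [Matrix.det_fin_two, e3, e1] at hN
  norm_num at hN

/-- Cayley–Hamilton gives the powers of `M` the Chebyshev recursion satisfied by `sin (k θ)`;
multiplying by `sin θ` avoids a division. -/
theorem sin_smul_pow {M : Matrix (Fin 2) (Fin 2) ℝ} {θ : ℝ} (hdet : M.det = 1)
    (htr : M.trace = 2 * Real.cos θ) (k : ℕ) :
    Real.sin θ • M ^ k = Real.sin (k * θ) • M - Real.sin (k * θ - θ) • 1 := by
  have hsq : M * M = (2 * Real.cos θ) • M - 1 := by
    rw [Matrix.det_fin_two] at hdet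
    rw [← htr, Matrix.trace_fin_two]
    ext i j
    fin_cases i <;> fin_cases j <;>
      simp [Matrix.mul_apply, Fin.sum_univ_two] <;>
      first | ring1 | linear_combination (-1) * hdet
  induction k with
  | zero => simp
  | succ k ih =>
    rw [pow_succ, ← Matrix.smul_mul, ih, Matrix.sub_mul, Matrix.smul_mul, Matrix.smul_mul, hsq,
      Matrix.one_mul, smul_sub, smul_smul]
    have h1 : Real.sin ((k + 1 : ℕ) * θ)
        = Real.sin (k * θ) * (2 * Real.cos θ) - Real.sin (k * θ - θ) := by
      push_cast
      rw [add_mul, one_mul, Real.sin_add, Real.sin_sub]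
      ring
    rw [h1, show ((k + 1 : ℕ) : ℝ) * θ - θ = k * θ by push_cast; ring, sub_smul]
    abel

theorem pow_eq_cos_smul_one {M : Matrix (Fin 2) (Fin 2) ℝ} {θ : ℝ} (hdet : M.det = 1)
    (htr : M.trace = 2 * Real.cos θ) (hθ : Real.sin θ ≠ 0) {m : ℕ}
    (hm : Real.sin (m * θ) = 0) : M ^ m = Real.cos (m * θ) • 1 := by
  have h := sin_smul_pow hdet htr m
  rw [Real.sin_sub, hm, zero_smul, zero_mul, zero_sub, zero_sub, neg_smul, neg_neg, mul_comm,
    mul_smul] at h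
  exact smul_right_injective _ hθ h

theorem transferMatrix_mul {x : ℤ → ℝ} {q : ℕ} (hx : ∀ n, x (n + q) = x n) (m : ℕ) :
    transferMatrix x (q * m) 0 = transferMatrix x q 0 ^ m := by
  induction m with
  | zero => rfl
  | succ m ih =>
    rw [mul_add, mul_one, transferMatrix_add, ih, transferMatrix_period (periodic_mul hx m),
      pow_succ']

/-- Once `π / m < b - a`, the grid of multiples of `π / m` meets the interval. All large `m` are
allowed because the usable periods are restricted later. -/
theorem exists_rational_angle {a b : ℝ} (ha : 0 ≤ a) (hab : a < b) :
    ∃ K : ℕ, ∀ m : ℕ, K ≤ m → 0 < m ∧ ∃ k : ℕ, a < k * Real.pi / m ∧ k * Real.pi / m < b := by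
  have hπ := Real.pi_pos
  obtain ⟨K, hK⟩ := exists_nat_gt (Real.pi / (b - a))
  have hK0 : (0 : ℝ) < K := (div_pos hπ (sub_pos.mpr hab)).trans hK
  refine ⟨K, fun m hm => ?_⟩
  have hmK : (K : ℝ) ≤ m := by exact_mod_cast hm
  have hm0 : (0 : ℝ) < m := hK0.trans_le hmK
  refine ⟨by exact_mod_cast hm0, ⌊a * m / Real.pi⌋₊ + 1, ?_, ?_⟩
  · rw [lt_div_iff₀ hm0, ← div_lt_iff₀ hπ]
    exact_mod_cast Nat.lt_floor_add_one _
  · have h1 : (⌊a * m / Real.pi⌋₊ : ℝ) ≤ a * m / Real.pi := Nat.floor_le (by positivity)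
    rw [le_div_iff₀ hπ] at h1
    rw [div_lt_iff₀ (sub_pos.mpr hab)] at hK
    rw [div_lt_iff₀ hm0]
    push_cast
    nlinarith [sub_pos.mpr hab]

/-- Either a perturbation at two sites already gives a trace outside `[-2, 2]`, or the trace moves
through an interval inside it and can be tuned to `2 cos (k π / m)`. Then the monodromy over `q * m`
sites is `±1`, a closed gap, which a second perturbation opens. -/
theorem exists_gap_perturbation {x : ℤ → ℝ} {q : ℕ} (hq : 2 ≤ q) (hx : ∀ n, x (n + q) = x n)
    {ε : ℝ} (hε : 0 < ε) : ∃ K : ℕ, ∀ m : ℕ, K ≤ m → ∃ y : ℤ → ℝ,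
      (∀ n, y (n + (q * m : ℕ)) = y n) ∧ (∀ n, |y n - x n| ≤ ε) ∧ ∃ η > 0, BoundedBelow y η := by
  set N := transferMatrix x (q - 2) 2 with hN
  have hNdet : N.det = 1 := det_transferMatrix _ _ _
  set F : ℝ → ℝ → ℝ := fun s t => (N * (stepMatrix (x 1 + t) * stepMatrix (x 0 + s))).trace with hF
  by_cases hA : ∃ s t : ℝ, |s| ≤ ε / 2 ∧ |t| ≤ ε / 2 ∧ 2 < |F s t|
  · obtain ⟨s, t, hs, ht, h2⟩ := hA
    have hper := perturb_periodic hx s t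
    obtain ⟨B, hB, hbound⟩ := exists_bound_of_periodic (by omega) hper
    refine ⟨0, fun m _ => ⟨perturb x q s t, periodic_mul hper m, fun n => ?_,
      boundedBelow_of_two_lt_abs_trace hB hbound hper ?_⟩⟩
    · exact (abs_perturb_sub_le x q hs ht n).trans (by linarith)
    · rw [transferMatrix_perturb x hq]
      exact h2
  · push Not at hA
    obtain ⟨s, t, hs, ht, hne⟩ := exists_trace_ne hNdet (x 0) (x 1) (half_pos hε)
    -- Along the segment from `(0, 0)` to `(s, t)` the trace takes every value between two distinct
    -- ones.
    have hne' : F s t ≠ F 0 0 := by simpa [hF] using hne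
    have hscale : ∀ u ∈ Set.uIcc (0 : ℝ) 1, ∀ r : ℝ, |r| ≤ ε / 2 → |u * r| ≤ ε / 2 := by
      intro u hu r hr
      rw [Set.uIcc_of_le zero_le_one] at hu
      rw [abs_mul, abs_of_nonneg hu.1]
      exact (mul_le_of_le_one_left (abs_nonneg r) hu.2).trans hr
    have hcont : Continuous fun u : ℝ => F (u * s) (u * t) := by
      simp only [hF, trace_mul_stepMatrix]
      fun_prop
    have hivt := intermediate_value_uIcc (hcont.continuousOn (s := Set.uIcc 0 1))
    simp only [zero_mul, one_mul] at hivt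
    have hb0 : |F 0 0| ≤ 2 := hA 0 0 (by simpa using (half_pos hε).le)
      (by simpa using (half_pos hε).le)
    have hb1 : |F s t| ≤ 2 := hA s t hs ht
    rw [abs_le] at hb0 hb1
    obtain ⟨a, b, ha, hb, hab, hval⟩ : ∃ a b : ℝ, 0 ≤ a ∧ b ≤ Real.pi ∧ a < b ∧
        ∀ θ, a < θ → θ < b → 2 * Real.cos θ ∈ Set.uIcc (F 0 0) (F s t) := by
      have hc0 : 2 * Real.cos (Real.arccos (F 0 0 / 2)) = F 0 0 := by
        rw [Real.cos_arccos (by linarith) (by linarith)]; ring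
      have hc1 : 2 * Real.cos (Real.arccos (F s t / 2)) = F s t := by
        rw [Real.cos_arccos (by linarith) (by linarith)]; ring
      rcases lt_trichotomy (Real.arccos (F 0 0 / 2)) (Real.arccos (F s t / 2)) with h | h | h
      · refine ⟨_, _, Real.arccos_nonneg _, Real.arccos_le_pi _, h, fun θ h1 h2 => ?_⟩
        have i1 := Real.cos_le_cos_of_nonneg_of_le_pi (Real.arccos_nonneg _)
          (h2.le.trans (Real.arccos_le_pi _)) h1.le
        have i2 := Real.cos_le_cos_of_nonneg_of_le_pi ((Real.arccos_nonneg _).trans h1.le)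
          (Real.arccos_le_pi _) h2.le
        exact Set.mem_uIcc.mpr (Or.inr ⟨by linarith, by linarith⟩)
      · rw [h, hc1] at hc0
        exact absurd hc0 hne'
      · refine ⟨_, _, Real.arccos_nonneg _, Real.arccos_le_pi _, h, fun θ h1 h2 => ?_⟩
        have i1 := Real.cos_le_cos_of_nonneg_of_le_pi (Real.arccos_nonneg _)
          (h2.le.trans (Real.arccos_le_pi _)) h1.le
        have i2 := Real.cos_le_cos_of_nonneg_of_le_pi ((Real.arccos_nonneg _).trans h1.le)
          (Real.arccos_le_pi _) h2.le
        exact Set.mem_uIcc.mpr (Or.inl ⟨by linarith, by linarith⟩)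
    obtain ⟨K, hK⟩ := exists_rational_angle ha hab
    refine ⟨K, fun m hm => ?_⟩
    obtain ⟨hm0, k, hk1, hk2⟩ := hK m hm
    set θ := k * Real.pi / m with hθ
    obtain ⟨u, hu, hFu⟩ := hivt (hval θ hk1 hk2)
    have hmθ : m * θ = k * Real.pi := by
      rw [hθ]
      field_simp
    have hsin : Real.sin θ ≠ 0 :=
      (Real.sin_pos_of_pos_of_lt_pi (ha.trans_lt hk1) (hk2.trans_le hb)).ne'
    set y := perturb x q (u * s) (u * t) with hy
    have hyper : ∀ n, y (n + q) = y n := perturb_periodic hx _ _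
    have hpow : transferMatrix y (q * m) 0 = Real.cos (m * θ) • 1 := by
      rw [transferMatrix_mul hyper]
      refine pow_eq_cos_smul_one (det_transferMatrix _ _ _) ?_ hsin ?_
      · rw [hy, transferMatrix_perturb x hq]
        exact hFu
      · rw [hmθ, Real.sin_nat_mul_pi]
    have hqm : 2 ≤ q * m := hq.trans (Nat.le_mul_of_pos_right q hm0)
    have hzper : ∀ n, perturb y (q * m) (ε / 2) (-(ε / 2)) (n + (q * m : ℕ))
        = perturb y (q * m) (ε / 2) (-(ε / 2)) n :=
      perturb_periodic (periodic_mul hyper m) _ _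
    have hε2 : |ε / 2| ≤ ε / 2 := (abs_of_pos (half_pos hε)).le
    obtain ⟨B, hB, hbound⟩ := exists_bound_of_periodic (by omega) hzper
    refine ⟨perturb y (q * m) (ε / 2) (-(ε / 2)), hzper, fun n => ?_,
      boundedBelow_of_two_lt_abs_trace hB hbound hzper ?_⟩
    · have i1 := abs_perturb_sub_le y (q * m) hε2 ((abs_neg (ε / 2)).trans_le hε2) n
      have i2 := abs_perturb_sub_le x q (hscale u hu s hs) (hscale u hu t ht) n
      calc _ = |(perturb y (q * m) (ε / 2) (-(ε / 2)) n - y n) + (y n - x n)| := by ring_nf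
        _ ≤ _ := abs_add_le _ _
        _ ≤ ε / 2 + ε / 2 := add_le_add i1 i2
        _ = ε := by ring
    · rw [transferMatrix_split _ hqm] at hpow
      rw [transferMatrix_perturb y hqm, trace_mul_stepMatrix_of_eq_smul_one hpow, hmθ,
        Real.cos_nat_mul_pi, abs_mul, abs_pow, abs_neg, abs_one, one_pow, one_mul,
        abs_of_pos (by positivity)]
      have : 0 < (ε / 2) ^ 2 := by positivity
      linarith

/-! ### Exponential decay on stretches where the energy is in a gap -/

theorem BoundedBelow.mono {x : ℤ → ℝ} {η η' : ℝ} (h : BoundedBelow x η) (hη : η' ≤ η) :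
    BoundedBelow x η' := fun ψ c hc =>
  (mul_le_mul_of_nonneg_right hη (norm_nonneg _)).trans (h ψ c hc)

theorem abs_pow_sub_pow_le {ρ : ℝ} (hρ : 1 ≤ ρ) {a b : ℕ} (hab : a ≤ b + 1) (hba : b ≤ a + 1) :
    |ρ ^ a - ρ ^ b| ≤ (ρ - 1) * ρ ^ b := by
  have h0 : 0 ≤ ρ - 1 := by linarith
  obtain h | h | h : a = b ∨ a = b + 1 ∨ b = a + 1 := by omega
  · subst h
    rw [sub_self, abs_zero]
    positivity
  · subst h
    rw [pow_succ, show ρ ^ b * ρ - ρ ^ b = (ρ - 1) * ρ ^ b by ring, abs_of_nonneg (by positivity)]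
  · subst h
    rw [pow_succ, show ρ ^ a - ρ ^ a * ρ = -((ρ - 1) * ρ ^ a) by ring, abs_neg,
      abs_of_nonneg (by positivity)]
    have : 0 ≤ (ρ - 1) * ρ ^ a := by positivity
    nlinarith

/-- A Combes–Thomas estimate with weight `ρ ^ w - 1`, where `w` is a depth function vanishing
outside the set where `x` and `y` agree. -/
theorem weighted_bound {x y : ℤ → ℝ} {η : ℝ} (hη : 0 < η) (hy : BoundedBelow y η) {w : ℤ → ℕ}
    {L : ℕ} (hwL : ∀ n, w n ≤ L) (hw1 : ∀ n, w (n + 1) ≤ w n + 1) (hw2 : ∀ n, w n ≤ w (n + 1) + 1)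
    (hxy : ∀ n, 0 < w n → x n = y n) (ψ : EllTwo) {c : ℝ} (hc : L2Le (residual x ψ) c) :
    L2Le (fun n => (((1 + η / 4) ^ w n - 1 : ℝ) : ℂ) * ψ n)
      (‖ψ‖ + 2 / η * (1 + η / 4) ^ L * c) := by
  set ρ : ℝ := 1 + η / 4 with hρdef
  have hρ : 1 ≤ ρ := by rw [hρdef]; linarith
  set χ : ℤ → ℝ := fun n => ρ ^ w n - 1 with hχ
  have hχ0 : ∀ n, 0 ≤ χ n := fun n => sub_nonneg.mpr (one_le_pow₀ hρ)
  have hχL : ∀ n, |χ n| ≤ ρ ^ L := fun n => by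
    rw [abs_of_nonneg (hχ0 n)]
    have := pow_le_pow_right₀ hρ (hwL n)
    simp only [hχ]
    linarith
  have hL0 : 0 ≤ ρ ^ L := by positivity
  obtain ⟨U, hU, -⟩ := (L2Le.of_coe ψ).mul_left hL0 hχL
  have hUle : L2Le (fun n => (χ n : ℂ) * ψ n) ‖U‖ := ⟨U, hU, le_rfl⟩
  have hV : L2Le (fun n => ((ρ ^ w n : ℝ) : ℂ) * ψ n) (‖U‖ + ‖ψ‖) := by
    convert hUle.add (L2Le.of_coe ψ) using 1
    funext n
    simp only [hχ]
    push_cast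
    ring
  have hjump : ∀ n m, (m = n + 1 ∨ n = m + 1) →
      ‖((χ m - χ n : ℝ) : ℂ) * ψ m‖ ≤ (ρ - 1) * ‖((ρ ^ w m : ℝ) : ℂ) * ψ m‖ := by
    intro n m hnm
    have h1 : w m ≤ w n + 1 ∧ w n ≤ w m + 1 := by
      rcases hnm with rfl | rfl
      · exact ⟨hw1 n, hw2 n⟩
      · exact ⟨hw2 m, hw1 m⟩
    rw [norm_mul, norm_mul, Complex.norm_real, Complex.norm_real, Real.norm_eq_abs,
      Real.norm_of_nonneg (by positivity : 0 ≤ ρ ^ w m), ← mul_assoc]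
    gcongr
    rw [abs_sub_comm, show χ n - χ m = ρ ^ w n - ρ ^ w m by simp [hχ]]
    exact abs_pow_sub_pow_le hρ h1.2 h1.1
  have hρ0 : 0 ≤ ρ - 1 := by linarith
  have hleft : L2Le (fun n => ((χ (n - 1) - χ n : ℝ) : ℂ) * ψ (n - 1))
      ((ρ - 1) * (‖U‖ + ‖ψ‖)) :=
    (hV.shift (-1)).of_norm_le hρ0 fun n => by
      rw [← sub_eq_add_neg]
      exact hjump n (n - 1) (Or.inr (by ring))
  have hright : L2Le (fun n => ((χ (n + 1) - χ n : ℝ) : ℂ) * ψ (n + 1))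
      ((ρ - 1) * (‖U‖ + ‖ψ‖)) :=
    (hV.shift 1).of_norm_le hρ0 fun n => hjump n (n + 1) (Or.inl rfl)
  -- Here `U` is the weighted vector. Moving the weight past the two hopping terms costs `2 (ρ - 1)
  -- = η / 2` times `‖U‖ + ‖ψ‖`, and the `‖U‖` part is absorbed by the gap `η`. Subtracting 1 from
  -- the weight makes it vanish where `x` and `y` may differ.
  have hres := hy U _ (by
    convert ((hc.mul_left hL0 hχL).add hleft).add hright using 1
    funext n
    have hz : (χ n : ℂ) * x n = χ n * y n := by
      rcases Nat.eq_zero_or_pos (w n) with h0 | hpos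
      · simp [hχ, h0]
      · rw [hxy n hpos]
    simp only [residual, hU]
    push_cast
    linear_combination (ψ n) * hz)
  refine hUle.mono ?_
  have hρη : ρ - 1 = η / 4 := by rw [hρdef]; ring
  rw [hρη] at hres
  have h4 : η / 2 * ‖U‖ ≤ ρ ^ L * c + η / 2 * ‖ψ‖ := by linarith
  calc ‖U‖ = 2 / η * (η / 2 * ‖U‖) := by field_simp
    _ ≤ 2 / η * (ρ ^ L * c + η / 2 * ‖ψ‖) := by gcongr
    _ = _ := by field_simp; ring

/-! ### Decoupled blocks -/

/-- The restriction of `Δ + v` to the sites `b, …, b + N - 1`. -/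
def blockMatrix (v : ℤ → ℝ) (b : ℤ) (N : ℕ) : Matrix (Fin N) (Fin N) ℂ := fun i j =>
  (if (j : ℕ) + 1 = i then 1 else 0) + (if (i : ℕ) + 1 = j then 1 else 0)
    + if i = j then (v (b + i) : ℂ) else 0

theorem blockMatrix_isHermitian (v : ℤ → ℝ) (b : ℤ) (N : ℕ) : (blockMatrix v b N).IsHermitian := by
  ext i j
  simp only [Matrix.conjTranspose_apply, blockMatrix, star_add]
  rw [add_comm (star _) (star _)]
  by_cases h : i = j
  · subst h
    simp
  · rw [if_neg h, if_neg (Ne.symm h)]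
    split_ifs <;> simp

theorem blockMatrix_mulVec (v : ℤ → ℝ) (b : ℤ) (N : ℕ) (u : ℤ → ℂ) (i : Fin N) :
    (blockMatrix v b N).mulVec (fun j : Fin N => u j) i =
      (if (i : ℤ) = 0 then 0 else u (i - 1)) + (if (i : ℤ) = N - 1 then 0 else u (i + 1))
        + v (b + i) * u i := by
  have hi := i.isLt
  simp only [Matrix.mulVec, dotProduct, blockMatrix, add_mul, ite_mul, one_mul, zero_mul,
    Finset.sum_add_distrib]
  congr 1
  · congr 1
    · split_ifs with h0
      · exact Finset.sum_eq_zero fun j _ => if_neg (by omega)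
      · rw [Finset.sum_eq_single (⟨i - 1, by omega⟩ : Fin N)]
        · rw [if_pos (by simp only; omega)]
          congr 1
          simp only
          omega
        · intro j _ hj
          exact if_neg fun h => hj (Fin.ext (by simp only; omega))
        · simp
    · split_ifs with h0
      · exact Finset.sum_eq_zero fun j _ => if_neg (by omega)
      · rw [Finset.sum_eq_single (⟨i + 1, by omega⟩ : Fin N)]
        · rw [if_pos rfl]
          congr 1
        · intro j _ hj
          exact if_neg fun h => hj (Fin.ext (by simp only; omega))
        · simp
  · simp

/-- `F` consists of the eigenvalues of the Hermitian block, chosen before `τ` and `E`. -/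
theorem blockMatrix_bound (v : ℤ → ℝ) (b : ℤ) (N : ℕ) :
    ∃ F : Finset ℝ, F.card ≤ N ∧ ∀ τ > 0, ∀ E : ℝ, (∀ y ∈ F, τ ≤ |y - E|) → ∀ u : Fin N → ℂ,
      τ ^ 2 * ∑ i, ‖u i‖ ^ 2 ≤ ∑ i, ‖(blockMatrix v b N).mulVec u i - E * u i‖ ^ 2 := by
  have hH := blockMatrix_isHermitian v b N
  refine ⟨Finset.univ.image hH.eigenvalues, Finset.card_image_le.trans (by simp), ?_⟩
  intro τ hτ E hE u
  have hA : IsSelfAdjoint (Matrix.toEuclideanCLM (𝕜 := ℂ) (blockMatrix v b N)) :=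
    IsSelfAdjoint.map hH _
  have hspec : ∀ y ∈ realSpectrum (Matrix.toEuclideanCLM (𝕜 := ℂ) (blockMatrix v b N)),
      τ ≤ |y - E| := by
    intro y hy
    refine hE y ?_
    have h1 : (y : ℂ) ∈ spectrum ℂ (blockMatrix v b N) := by
      rw [← AlgEquiv.spectrum_eq (Matrix.toEuclideanCLM (n := Fin N) (𝕜 := ℂ))]
      exact hy
    have h2 : y ∈ spectrum ℝ (blockMatrix v b N) := (spectrum.algebraMap_mem_iff ℂ).mp h1
    rw [hH.spectrum_real_eq_range_eigenvalues] at h2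
    obtain ⟨i, rfl⟩ := h2
    exact Finset.mem_image_of_mem _ (Finset.mem_univ i)
  have h := bound_of_dist_spectrum hA hτ hspec (WithLp.toLp 2 u)
  have h2 := pow_le_pow_left₀ (by positivity) h 2
  rw [mul_pow, EuclideanSpace.norm_sq_eq, EuclideanSpace.norm_sq_eq] at h2
  have h3 : ∀ i, shifted (Matrix.toEuclideanCLM (𝕜 := ℂ) (blockMatrix v b N)) E (WithLp.toLp 2 u) i
      = (blockMatrix v b N).mulVec u i - E * u i := fun i => by
    rw [shifted_apply]
    simp
  simp only [h3] at h2
  exact h2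

theorem summable_sq (ψ : EllTwo) : Summable fun n => ‖ψ n‖ ^ 2 := by
  simpa using (lp.memℓp ψ).summable (by norm_num)

theorem hasSum_norm_sq (ψ : EllTwo) : HasSum (fun n => ‖ψ n‖ ^ 2) (‖ψ‖ ^ 2) := by
  have h : ‖ψ‖ ^ 2 = ∑' n, ‖ψ n‖ ^ 2 := by
    simpa using lp.norm_rpow_eq_tsum (p := 2) (by norm_num) ψ
  rw [h]
  exact (summable_sq ψ).hasSum

/-- The enumeration of `ℤ` by blocks of length `N` starting at `b`. -/
def blockEquiv (b : ℤ) (N : ℕ) [NeZero N] : ℤ × Fin N ≃ ℤ :=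
  (Int.divModEquiv N).symm.trans (Equiv.addRight b)

theorem blockEquiv_apply (b : ℤ) (N : ℕ) [NeZero N] (k : ℤ) (i : Fin N) :
    blockEquiv b N (k, i) = k * N + i + b := by
  simp [blockEquiv, Int.divModEquiv]

theorem hasSum_blocks (b : ℤ) (N : ℕ) [NeZero N] {f : ℤ → ℝ} {a : ℝ} (hf : HasSum f a) :
    HasSum (fun k : ℤ => ∑ i : Fin N, f (k * N + i + b)) a := by
  have hs : HasSum (fun p => f (blockEquiv b N p)) a := (blockEquiv b N).hasSum_iff.mpr hf
  have := hs.prod_fiberwise fun k => hasSum_fintype _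
  simpa only [blockEquiv_apply] using this

theorem norm_le_of_blocks {ψ φ : EllTwo} {τ : ℝ} (b : ℤ) (N : ℕ) [NeZero N]
    (h : ∀ k : ℤ, τ ^ 2 * ∑ i : Fin N, ‖ψ (k * N + i + b)‖ ^ 2
      ≤ ∑ i : Fin N, ‖φ (k * N + i + b)‖ ^ 2) : τ * ‖ψ‖ ≤ ‖φ‖ := by
  have hblock : ∀ χ : EllTwo,
      HasSum (fun k : ℤ => ∑ i : Fin N, ‖χ (k * N + i + b)‖ ^ 2) (‖χ‖ ^ 2) := fun χ =>
    hasSum_blocks b N (f := fun n => ‖χ n‖ ^ 2) (hasSum_norm_sq χ)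
  have h2 := hasSum_le h ((hblock ψ).mul_left (τ ^ 2)) (hblock φ)
  rw [← mul_pow] at h2
  exact le_of_sq_le_sq h2 (norm_nonneg _)

/-- The subtracted terms are the links across the cuts at `b` modulo `N`. By periodicity all
remaining blocks are the same matrix, so `N` exceptional energies suffice for the whole line. -/
theorem decoupled_bound {v : ℤ → ℝ} {N : ℕ} (hN : 0 < N) (hv : ∀ n, v (n + N) = v n) (b : ℤ) :
    ∃ F : Finset ℝ, F.card ≤ N ∧ ∀ τ > 0, ∀ E : ℝ, (∀ y ∈ F, τ ≤ |y - E|) →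
      ∀ (ψ : EllTwo) (c : ℝ), L2Le (fun n => residual (fun n => E - v n) ψ n
        - ((if (n - b) % N = 0 then ψ (n - 1) else 0)
          + if (n - b) % N = N - 1 then ψ (n + 1) else 0)) c → τ * ‖ψ‖ ≤ c := by
  obtain ⟨F, hF, hbound⟩ := blockMatrix_bound v b N
  have : NeZero N := ⟨hN.ne'⟩
  refine ⟨F, hF, fun τ hτ E hE ψ c ⟨φ, hφ, hc⟩ => le_trans ?_ hc⟩
  refine norm_le_of_blocks b N fun k => ?_
  refine (hbound τ hτ E hE fun i => ψ (k * N + i + b)).trans_eq (Finset.sum_congr rfl fun i _ => ?_)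
  congr 2
  have hi := i.isLt
  have hmod : (k * N + i + b - b) % N = (i : ℤ) := by
    rw [add_sub_cancel_right, add_comm, Int.add_mul_emod_self_right]
    exact Int.emod_eq_of_lt (by omega) (by omega)
  have hvk : v (k * N + i + b) = v (b + i) := by
    rw [← periodic_emod hv, ← periodic_emod hv (b + i),
      show k * N + i + b = b + i + k * N by ring, Int.add_mul_emod_self_right]
  rw [blockMatrix_mulVec v b N (fun j => ψ (k * N + j + b)) i, hφ]
  beta_reduce
  rw [hmod]
  simp only [residual, hvk]
  rw [show k * N + i + b - 1 = k * N + (i - 1) + b by ring,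
    show k * N + i + b + 1 = k * N + (i + 1) + b by ring]
  split_ifs <;> push_cast <;> ring

/-! ### Periodic potentials with thin spectrum -/

/-- If the energy lies in a gap of `v'`, and `v` agrees with `v'` on long stretches, then it can
only be in the spectrum of `v` if it is close to the spectrum of the operator decoupled in the
middle of the stretches. -/
theorem boundedBelow_of_decoupled {v v' : ℤ → ℝ} {N : ℕ} {b : ℤ} {τ η E : ℝ} (hτ : 0 < τ)
    (hη : 0 < η)
    (hdec : ∀ (ψ : EllTwo) (c : ℝ), L2Le (fun n => residual (fun n => E - v n) ψ n
        - ((if (n - b) % N = 0 then ψ (n - 1) else 0)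
          + if (n - b) % N = N - 1 then ψ (n + 1) else 0)) c → τ * ‖ψ‖ ≤ c)
    (hgap : BoundedBelow (fun n => E - v' n) η) {w : ℤ → ℕ} {L W : ℕ}
    (hwL : ∀ n, w n ≤ L) (hw1 : ∀ n, w (n + 1) ≤ w n + 1) (hw2 : ∀ n, w n ≤ w (n + 1) + 1)
    (hvv : ∀ n, 0 < w n → v n = v' n)
    (hW1 : ∀ n : ℤ, (n - b) % N = 0 → W ≤ w (n - 1))
    (hW2 : ∀ n : ℤ, (n - b) % N = N - 1 → W ≤ w (n + 1))
    (hWτ : 4 + τ ≤ τ * (1 + η / 4) ^ W) :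
    BoundedBelow (fun n => E - v n) (τ / 2 / (1 + τ / η * (1 + η / 4) ^ L)) := by
  intro ψ c hc
  set ρ : ℝ := 1 + η / 4 with hρdef
  have hρ : 1 ≤ ρ := by rw [hρdef]; linarith
  have hweight := weighted_bound hη hgap hwL hw1 hw2 (fun n hn => by rw [hvv n hn]) ψ hc
  set d := ‖ψ‖ + 2 / η * ρ ^ L * c with hd
  have hd0 : 0 ≤ d := hweight.nonneg
  -- `hWτ` says that at depth `W` the weight is at least `4 / τ`.
  have hWle : ∀ n, W ≤ w n → ‖ψ n‖ ≤ τ / 4 * ‖((ρ ^ w n - 1 : ℝ) : ℂ) * ψ n‖ := by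
    intro n hn
    have h1 : ρ ^ W ≤ ρ ^ w n := pow_le_pow_right₀ hρ hn
    have h2 : 0 ≤ ρ ^ w n - 1 := sub_nonneg.mpr (one_le_pow₀ hρ)
    have h3 : 1 ≤ τ / 4 * (ρ ^ w n - 1) := by nlinarith
    rw [norm_mul, Complex.norm_real, Real.norm_of_nonneg h2, ← mul_assoc]
    exact le_mul_of_one_le_left (norm_nonneg _) h3
  have hl : L2Le (fun n => if (n - b) % N = 0 then ψ (n - 1) else 0) (τ / 4 * d) := by
    refine (hweight.shift (-1)).of_norm_le (by positivity) fun n => ?_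
    rw [← sub_eq_add_neg]
    split_ifs with h
    · exact hWle (n - 1) (hW1 n h)
    · rw [norm_zero]
      positivity
  have hr : L2Le (fun n => if (n - b) % N = N - 1 then ψ (n + 1) else 0) (τ / 4 * d) := by
    refine (hweight.shift 1).of_norm_le (by positivity) fun n => ?_
    split_ifs with h
    · exact hWle (n + 1) (hW2 n h)
    · rw [norm_zero]
      positivity
  -- The two families of cut links contribute at most `τ / 2 * ‖ψ‖`, half of the available lower
  -- bound, plus a multiple of `c`.
  have h := hdec ψ _ (hc.sub (hl.add hr))
  have hpos : 0 < 1 + τ / η * ρ ^ L := by positivity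
  rw [div_mul_eq_mul_div, div_le_iff₀ hpos]
  have e : τ / 4 * d + τ / 4 * d = τ / 2 * ‖ψ‖ + τ / η * ρ ^ L * c := by
    rw [hd]
    field_simp
    ring
  linarith

/-- The depth of `n` modulo `N` inside the interval `[p, p + h)`. -/
def depth (N h p : ℕ) (n : ℤ) : ℕ := (min (n % N - p) (p + h - 1 - n % N)).toNat

theorem emod_succ_cases (n : ℤ) {N : ℕ} (hN : 0 < N) :
    ((n + 1) % N = n % N + 1) ∨ (n % N = N - 1 ∧ (n + 1) % N = 0) := by
  have h0 : 0 ≤ n % N := Int.emod_nonneg _ (by omega)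
  have h1 : n % N < N := Int.emod_lt_of_pos _ (by omega)
  rw [← Int.emod_add_emod]
  by_cases h : n % N = N - 1
  · right
    rw [h]
    simp
  · left
    exact Int.emod_eq_of_lt (by omega) (by omega)

theorem depth_succ_le {N h p : ℕ} (hN : 0 < N) (hp : p + h ≤ N) (n : ℤ) :
    depth N h p (n + 1) ≤ depth N h p n + 1 := by
  have h0 : 0 ≤ n % N := Int.emod_nonneg _ (by omega)
  unfold depth
  rcases emod_succ_cases n hN with h' | ⟨h', h''⟩ <;> omega

theorem depth_le_succ {N h p : ℕ} (hN : 0 < N) (hp : p + h ≤ N) (n : ℤ) :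
    depth N h p n ≤ depth N h p (n + 1) + 1 := by
  have h0 : 0 ≤ n % N := Int.emod_nonneg _ (by omega)
  unfold depth
  rcases emod_succ_cases n hN with h' | ⟨h', h''⟩ <;> omega

theorem depth_le (N h p : ℕ) (n : ℤ) : depth N h p n ≤ h := by
  unfold depth
  omega

theorem le_depth {N h p W : ℕ} {n : ℤ} (h1 : p + W ≤ n % N) (h2 : n % N + W + 1 ≤ p + h) :
    W ≤ depth N h p n := by
  unfold depth
  omega

theorem of_depth_pos {N h p : ℕ} {n : ℤ} (hn : 0 < depth N h p n) :
    p ≤ n % N ∧ n % N < p + h := by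
  unfold depth at hn
  omega

/-- The potential which, within each period of length `N`, agrees with `vs j` on the `j`-th
stretch of length `h`. -/
def concatenation (N h m : ℕ) (vs : ℕ → ℤ → ℝ) (n : ℤ) : ℝ := vs (min ((n % N).toNat / h) m) n

theorem exists_pow_ge {ρ : ℝ} (hρ : 1 < ρ) (a b : ℝ) : ∃ W₀ : ℕ, ∀ W : ℕ, W₀ ≤ W →
    a * W + b ≤ ρ ^ W := by
  have h1 := (tendsto_pow_const_div_const_pow_of_one_lt 1 hρ).const_mul a
  have h2 := (tendsto_pow_const_div_const_pow_of_one_lt 0 hρ).const_mul b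
  have h3 := h1.add h2
  rw [mul_zero, mul_zero, add_zero] at h3
  obtain ⟨W₀, h⟩ := Filter.eventually_atTop.mp (h3.eventually_le_const zero_lt_one)
  refine ⟨W₀, fun W hW => ?_⟩
  have hpos : 0 < ρ ^ W := by positivity
  have := h W hW
  rw [pow_one, pow_zero, ← mul_div_assoc, ← mul_div_assoc, ← add_div, div_le_one hpos,
    mul_one] at this
  exact this

/-- A set of admissible periods: positive, directed and unbounded with respect to divisibility. -/
structure IsPeriodSet (P : Set ℕ) : Prop where
  pos : ∀ a ∈ P, 0 < a
  nonempty : P.Nonempty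
  directed : ∀ a ∈ P, ∀ b ∈ P, ∃ c ∈ P, a ∣ c ∧ b ∣ c
  unbounded : ∀ a ∈ P, ∀ K : ℕ, ∃ c ∈ P, a ∣ c ∧ K ≤ c

theorem IsPeriodSet.exists_common {P : Set ℕ} (hP : IsPeriodSet P) {ι : Type*} (t : Finset ι)
    (a : ι → ℕ) (ha : ∀ i, a i ∈ P) : ∃ c ∈ P, ∀ i ∈ t, a i ∣ c := by
  classical
  induction t using Finset.induction_on with
  | empty =>
    obtain ⟨c, hc⟩ := hP.nonempty
    exact ⟨c, hc, by simp⟩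
  | insert i t _ ih =>
    obtain ⟨c, hc, h⟩ := ih
    obtain ⟨d, hd, h1, h2⟩ := hP.directed _ (ha i) c hc
    refine ⟨d, hd, fun j hj => ?_⟩
    rcases Finset.mem_insert.mp hj with rfl | hj
    · exact h1
    · exact (h j hj).trans h2

theorem exists_gap_at {P : Set ℕ} (hP : IsPeriodSet P) {v : ℤ → ℝ} {q : ℕ} (hq : q ∈ P)
    (hv : ∀ n, v (n + q) = v n) {ε : ℝ} (hε : 0 < ε) (E : ℝ) :
    ∃ N ∈ P, ∃ u : ℤ → ℝ, (∀ n, u (n + N) = u n) ∧ (∀ n, |u n - v n| ≤ ε) ∧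
      ∃ η > 0, BoundedBelow (fun n => E - u n) η := by
  -- The two perturbed sites must be distinct modulo the period.
  obtain ⟨q', hq', hdvd, h2⟩ := hP.unbounded q hq 2
  have hv' := periodic_of_dvd hv hdvd
  obtain ⟨K, hK⟩ := exists_gap_perturbation (x := fun n => E - v n) h2
    (fun n => by rw [hv']) hε
  obtain ⟨N, hN, ⟨m, rfl⟩, hle⟩ := hP.unbounded q' hq' (q' * K)
  obtain ⟨y, hper, hclose, η, hη, hb⟩ := hK m (Nat.le_of_mul_le_mul_left hle (by omega))
  refine ⟨q' * m, hN, fun n => E - y n, fun n => congrArg (E - ·) (hper n), fun n => ?_, η, hη, ?_⟩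
  · have := hclose n
    rw [abs_sub_comm] at this
    convert this using 2
    ring
  · convert hb using 2
    ring

/-- A gap persists for nearby energies, so compactness leaves finitely many potentials; energies of
large modulus are outside every spectrum involved. Directedness of `P` supplies a common period. -/
theorem exists_gap_family {P : Set ℕ} (hP : IsPeriodSet P) {v : ℤ → ℝ} {q : ℕ} (hq : q ∈ P)
    (hv : ∀ n, v (n + q) = v n) {ε : ℝ} (hε : 0 < ε) :
    ∃ N ∈ P, ∃ (m : ℕ) (vs : ℕ → ℤ → ℝ), (∀ j n, vs j (n + N) = vs j n) ∧
      (∀ j n, |vs j n - v n| ≤ ε) ∧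
      ∃ η > 0, ∀ E : ℝ, ∃ j < m, BoundedBelow (fun n => E - vs j n) η := by
  choose N hN u hu hclose η hη hb using exists_gap_at hP hq hv hε
  obtain ⟨B, hB, hbound⟩ := exists_bound_of_periodic (hP.pos q hq) hv
  obtain ⟨t, -, ht⟩ := (isCompact_Icc (a := -(3 + B + ε)) (b := 3 + B + ε)).elim_nhds_subcover
    (fun E => Metric.ball E (η E / 2)) fun E _ => Metric.ball_mem_nhds E (half_pos (hη E))
  classical
  -- The extra entry 0 keeps the list nonempty and makes the default value of `getD` one of its
  -- members.
  set l : List ℝ := 0 :: t.toList with hl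
  obtain ⟨M, hM, hdvd⟩ := hP.exists_common l.toFinset N hN
  obtain ⟨E₀, hE₀, hmin⟩ := l.toFinset.exists_min_image η ⟨0, by simp [hl]⟩
  have hmem : ∀ j : ℕ, l.getD j 0 ∈ l.toFinset := fun j => by
    rw [List.mem_toFinset]
    by_cases h : j < l.length
    · rw [List.getD_eq_getElem _ _ h]
      exact List.getElem_mem h
    · rw [List.getD_eq_default _ _ (not_lt.mp h)]
      simp [hl]
  refine ⟨M, hM, l.length, fun j => u (l.getD j 0),
    fun j n => periodic_of_dvd (hu _) (hdvd _ (hmem j)) n, fun j n => hclose _ n,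
    min 1 (η E₀ / 2), lt_min one_pos (half_pos (hη E₀)), fun E => ?_⟩
  by_cases hE : E ∈ Set.Icc (-(3 + B + ε)) (3 + B + ε)
  · obtain ⟨E₁, hE₁, hdist⟩ := Set.mem_iUnion₂.mp (ht hE)
    have hE₁l : E₁ ∈ l := by simp [hl, hE₁]
    obtain ⟨j, hj, hjE⟩ := List.getElem_of_mem hE₁l
    refine ⟨j, hj, ?_⟩
    beta_reduce
    rw [List.getD_eq_getElem _ _ hj, hjE]
    rw [Metric.mem_ball, Real.dist_eq] at hdist
    refine ((hb E₁).perturb (half_pos (hη E₁)).le (y := fun n => E - u E₁ n) fun n => ?_).mono ?_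
    · rw [sub_sub_sub_cancel_right, abs_sub_comm]
      exact hdist.le
    · have := hmin E₁ (List.mem_toFinset.mpr hE₁l)
      refine (min_le_right _ _).trans ?_
      linarith
  · refine ⟨0, by simp [hl], ?_⟩
    refine (boundedBelow_of_large fun n => ?_).mono (min_le_left _ _)
    have h1 : 3 + B + ε < |E| := by
      by_contra! h
      exact hE (abs_le.mp h)
    have h2 := abs_sub_abs_le_abs_sub E (u (l.getD 0 0) n)
    have h3 := abs_sub_abs_le_abs_sub (u (l.getD 0 0) n) (v n)
    have h4 := hclose (l.getD 0 0) n
    have h5 := hbound n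
    linarith

/-- There are at most `m * N` exceptional energies, with `N` linear in `W`, while `τ` decays like `ρ
^ (-W)`; so a long period makes the total length as small as desired. -/
theorem exists_thin_spectrum {P : Set ℕ} (hP : IsPeriodSet P) {v : ℤ → ℝ} {q : ℕ} (hq : q ∈ P)
    (hv : ∀ n, v (n + q) = v n) {ε δ : ℝ} (hε : 0 < ε) (hδ : 0 < δ) :
    ∃ N ∈ P, ∃ g : ℤ → ℝ, (∀ n, g (n + N) = g n) ∧ (∀ n, |g n - v n| ≤ ε) ∧
      ∃ (F : Finset ℝ) (τ : ℝ), 0 < τ ∧ F.card * τ ≤ δ ∧ ∃ c > 0, ∀ E : ℝ,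
        (∀ y ∈ F, τ ≤ |y - E|) → BoundedBelow (fun n => E - g n) c := by
  classical
  obtain ⟨M, hM, m, vs, hper, hclose, η, hη, hgap⟩ := exists_gap_family hP hq hv hε
  have hm : 0 < m := by
    obtain ⟨j, hj, -⟩ := hgap 0
    omega
  have hmR : (0 : ℝ) < m := by exact_mod_cast hm
  set ρ : ℝ := 1 + η / 4 with hρdef
  have hρ : 1 < ρ := by rw [hρdef]; linarith
  -- The coefficients come from requiring `m * (m * (2 * W + 4)) * (4 / (ρ ^ W - 1)) ≤ δ`; the
  -- summand 2 keeps `ρ ^ W - 1` positive.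
  obtain ⟨W₀, hW₀⟩ := exists_pow_ge hρ (8 * m ^ 2 / δ) (16 * m ^ 2 / δ + 2)
  obtain ⟨N, hN, hMN, hle⟩ := hP.unbounded M hM (m * (2 * W₀ + 2))
  have hN0 : 0 < N := hP.pos N hN
  set h := N / m with hh
  have hh2 : 2 * W₀ + 2 ≤ h := (Nat.le_div_iff_mul_le hm).mpr (by rwa [mul_comm])
  -- The depth guaranteed at the two sites adjacent to a cut in the middle of a stretch of length
  -- `h`.
  obtain ⟨W, hW⟩ : ∃ W, W = h / 2 - 1 := ⟨_, rfl⟩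
  have hWW₀ : W₀ ≤ W := by omega
  have hmh : m * h ≤ N := Nat.mul_div_le N m
  have hNle : (N : ℝ) ≤ m * (2 * W + 4) := by
    have h1 : N < m * (h + 1) := Nat.lt_mul_div_succ N hm
    have h2 : m * (h + 1) ≤ m * (2 * W + 4) := Nat.mul_le_mul_left m (by omega)
    exact_mod_cast (h1.le.trans h2)
  set g := concatenation N h m vs with hg
  have hperN : ∀ j n, vs j (n + N) = vs j n := fun j => periodic_of_dvd (hper j) hMN
  have hgper : ∀ n, g (n + N) = g n := fun n => by
    simp only [hg, concatenation, Int.add_emod_right, hperN]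
  choose F hFcard hF using fun j : ℕ => decoupled_bound hN0 hgper ((j * h + h / 2 : ℕ) : ℤ)
  -- The value for which the decay condition `4 + τ ≤ τ * ρ ^ W` is an equality.
  set τ : ℝ := 4 / (ρ ^ W - 1) with hτdef
  have hpow := hW₀ W hWW₀
  have hpow2 : 2 ≤ ρ ^ W := by
    have : 0 ≤ 8 * (m : ℝ) ^ 2 / δ * W := by positivity
    have : 0 ≤ 16 * (m : ℝ) ^ 2 / δ := by positivity
    linarith
  have hτ : 0 < τ := div_pos (by norm_num) (by linarith)
  refine ⟨N, hN, g, hgper, fun n => hclose _ n, (Finset.range m).biUnion F, τ, hτ, ?_,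
    τ / 2 / (1 + τ / η * ρ ^ h), by positivity, fun E hE => ?_⟩
  · have h1 : ((Finset.range m).biUnion F).card ≤ m * N := by
      refine Finset.card_biUnion_le.trans ((Finset.sum_le_card_nsmul _ _ N fun j _ =>
        hFcard j).trans ?_)
      simp
    have h2 : (((Finset.range m).biUnion F).card : ℝ) ≤ m * (m * (2 * W + 4)) := by
      refine le_trans (by exact_mod_cast h1) (?_ : (m : ℝ) * N ≤ _)
      gcongr
    calc _ ≤ m * (m * (2 * W + 4)) * τ := by gcongr
      _ = (8 * m ^ 2 * W + 16 * m ^ 2) / (ρ ^ W - 1) := by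
        rw [hτdef]
        ring
      _ ≤ δ := by
        rw [div_le_iff₀ (by linarith)]
        have h3 : 8 * (m : ℝ) ^ 2 / δ * W + 16 * m ^ 2 / δ ≤ ρ ^ W - 1 := by linarith
        calc _ = δ * (8 * (m : ℝ) ^ 2 / δ * W + 16 * m ^ 2 / δ) := by field_simp
          _ ≤ _ := by gcongr
  · obtain ⟨j, hj, hb⟩ := hgap E
    have hjh : j * h + h ≤ N := by
      have : (j + 1) * h ≤ m * h := Nat.mul_le_mul_right h hj
      rw [add_mul, one_mul] at this
      omega
    have hcut : ∀ (n : ℤ) (r : ℤ), (n - (j * h + h / 2 : ℕ)) % N = r →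
        n % N = ((j * h + h / 2 : ℕ) + r) % N := by
      intro n r hr
      rw [← hr, Int.add_emod_emod, add_sub_cancel]
    have hsmall : ∀ r : ℤ, 0 ≤ r → r < N → r % N = r := fun r => Int.emod_eq_of_lt
    refine boundedBelow_of_decoupled hτ hη
      (hF j τ hτ E fun y hy => hE y (Finset.mem_biUnion.mpr ⟨j, Finset.mem_range.mpr hj, hy⟩)) hb
      (w := depth N h (j * h)) (W := W) (depth_le N h _) (depth_succ_le hN0 hjh)
      (depth_le_succ hN0 hjh) (fun n hn => ?_) (fun n hn => ?_) (fun n hn => ?_) ?_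
    · obtain ⟨h1, h2⟩ := of_depth_pos hn
      have h3 : (n % N).toNat / h = j :=
        Nat.div_eq_of_lt_le (by omega) (by rw [add_mul, one_mul]; omega)
      rw [hg, concatenation, h3, min_eq_left hj.le]
    · have h1 : (n - 1) % N = (j * h + h / 2 : ℕ) - 1 := by
        have := hcut (n - 1) (-1 % N) (by
          rw [sub_right_comm, sub_eq_add_neg _ (1 : ℤ), ← Int.emod_add_emod, hn, zero_add])
        rw [this, Int.add_emod_emod, ← sub_eq_add_neg, hsmall _ (by omega) (by omega)]
      exact le_depth (by rw [h1]; push_cast; omega) (by rw [h1]; push_cast; omega)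
    · have h1 : (n + 1) % N = (j * h + h / 2 : ℕ) := by
        have := hcut (n + 1) 0 (by
          rw [add_sub_right_comm, ← Int.emod_add_emod, hn]
          simp)
        rw [this, add_zero, hsmall _ (by omega) (by omega)]
      exact le_depth (by rw [h1]; push_cast; omega) (by rw [h1]; push_cast; omega)
    · have hne : ρ ^ W - 1 ≠ 0 := by linarith
      have : τ * (ρ ^ W - 1) = 4 := by
        rw [hτdef]
        field_simp
      linarith

/-! ### Periodic sampling functions on a monothetic Cantor group -/

section CantorGroup

variable {Ω : Type*} [AddCommGroup Ω] [TopologicalSpace Ω] [IsTopologicalAddGroup Ω]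
  [CompactSpace Ω] {α : Ω}

theorem exists_openAddSubgroup_subset [T2Space Ω] [TotallyDisconnectedSpace Ω] {s : Set Ω}
    (hs : s ∈ 𝓝 0) : ∃ U : OpenAddSubgroup Ω, (U : Set Ω) ⊆ s := by
  obtain ⟨t, hts, ht, h0⟩ := mem_nhds_iff.mp hs
  obtain ⟨W, hW, h0W, hWt⟩ := compact_exists_isClopen_in_isOpen ht h0
  obtain ⟨U, hU⟩ :=
    IsTopologicalAddGroup.exist_openAddSubgroup_sub_clopen_nhds_of_zero hW h0W
  exact ⟨U, hU.trans (hWt.trans hts)⟩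

theorem exists_zsmul_sub_mem (hα : Dense (AddSubgroup.zmultiples α : Set Ω))
    (U : OpenAddSubgroup Ω) (ω : Ω) : ∃ a : ℤ, ω - a • α ∈ U := by
  have ho : IsOpen {z : Ω | ω - z ∈ (U : Set Ω)} :=
    U.isOpen.preimage (continuous_const.sub continuous_id)
  obtain ⟨z, hz, hzα⟩ := hα.inter_open_nonempty _ ho ⟨ω, by simp⟩
  obtain ⟨a, rfl⟩ := AddSubgroup.mem_zmultiples_iff.mp hzα
  exact ⟨a, hz⟩

theorem finite_quotient (U : OpenAddSubgroup Ω) : Finite (Ω ⧸ U.toAddSubgroup) :=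
  AddSubgroup.quotient_finite_of_isOpen U.toAddSubgroup U.isOpen

theorem index_pos (U : OpenAddSubgroup Ω) : 0 < U.toAddSubgroup.index := by
  have := finite_quotient U
  exact Nat.card_pos

/-- By density `α` generates the finite quotient by `U`, so its order there is the index. -/
theorem zsmul_mem_iff (hα : Dense (AddSubgroup.zmultiples α : Set Ω)) (U : OpenAddSubgroup Ω)
    (k : ℤ) : k • α ∈ U ↔ (U.toAddSubgroup.index : ℤ) ∣ k := by
  have := finite_quotient U
  have hgen : ∀ z : Ω ⧸ U.toAddSubgroup,
      z ∈ AddSubgroup.zmultiples (QuotientAddGroup.mk α : Ω ⧸ U.toAddSubgroup) := by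
    intro z
    obtain ⟨ω, rfl⟩ := QuotientAddGroup.mk_surjective z
    obtain ⟨a, ha⟩ := exists_zsmul_sub_mem hα U ω
    refine AddSubgroup.mem_zmultiples_iff.mpr ⟨a, ?_⟩
    rw [← QuotientAddGroup.mk_zsmul]
    refine (QuotientAddGroup.eq).mpr ?_
    rw [neg_add_eq_sub]
    exact ha
  have hord := addOrderOf_eq_card_of_forall_mem_zmultiples hgen
  rw [AddSubgroup.index, ← hord, addOrderOf_dvd_iff_zsmul_eq_zero, ← QuotientAddGroup.mk_zsmul,
    QuotientAddGroup.eq_zero_iff]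
  rfl

/-- The indices of the open subgroups of `Ω`. -/
def periods (Ω : Type*) [AddCommGroup Ω] [TopologicalSpace Ω] : Set ℕ :=
  {N | ∃ U : OpenAddSubgroup Ω, U.toAddSubgroup.index = N}

/-- Without isolated points `Ω` is infinite; an open subgroup avoiding the nonzero differences of
`K` points puts them in distinct cosets. -/
theorem exists_openAddSubgroup_le_index [T2Space Ω] [TotallyDisconnectedSpace Ω] [PerfectSpace Ω]
    (K : ℕ) : ∃ U : OpenAddSubgroup Ω, K ≤ U.toAddSubgroup.index := by
  classical
  have hinf : Infinite Ω := by
    by_contra hfin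
    rw [not_infinite_iff_finite] at hfin
    have h0 := accPt_iff_nhds.mp
      (PerfectSpace.univ_preperfect (α := Ω) (0 : Ω) (Set.mem_univ 0)) {0}
      ((isOpen_discrete _).mem_nhds rfl)
    obtain ⟨y, ⟨hy, -⟩, hne⟩ := h0
    exact hne hy
  obtain ⟨s, hs⟩ := Infinite.exists_subset_card_eq Ω K
  set D : Set Ω := ((s ×ˢ s).image fun p => p.1 - p.2 : Finset Ω) \ {0} with hD
  have hDfin : D.Finite := (Finset.finite_toSet _).sdiff
  obtain ⟨U, hU⟩ := exists_openAddSubgroup_subset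
    (hDfin.isClosed.isOpen_compl.mem_nhds (show (0 : Ω) ∈ Dᶜ by simp [hD]))
  refine ⟨U, ?_⟩
  have := finite_quotient U
  have := Fintype.ofFinite (Ω ⧸ U.toAddSubgroup)
  rw [AddSubgroup.index, Nat.card_eq_fintype_card, ← hs]
  refine Finset.card_le_card_of_injOn (fun ω => (QuotientAddGroup.mk ω : Ω ⧸ U.toAddSubgroup))
    (fun _ _ => Finset.mem_coe.mpr (Finset.mem_univ _)) fun a ha b hb hab => ?_
  by_contra hne
  have h1 : -a + b ∈ U := QuotientAddGroup.eq.mp hab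
  refine hU h1 ⟨?_, ?_⟩
  · rw [neg_add_eq_sub]
    exact Finset.mem_coe.mpr (Finset.mem_image.mpr
      ⟨(b, a), Finset.mem_product.mpr ⟨hb, ha⟩, rfl⟩)
  · rw [neg_add_eq_sub, Set.mem_singleton_iff, sub_eq_zero]
    exact Ne.symm hne

theorem isPeriodSet_periods [T2Space Ω] [TotallyDisconnectedSpace Ω] [PerfectSpace Ω] :
    IsPeriodSet (periods Ω) where
  pos := by
    rintro _ ⟨U, rfl⟩
    exact index_pos U
  nonempty := ⟨_, ⊤, rfl⟩
  directed := by
    rintro _ ⟨U, rfl⟩ _ ⟨U', rfl⟩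
    exact ⟨_, ⟨U ⊓ U', rfl⟩, AddSubgroup.index_dvd_of_le fun _ h => h.1,
      AddSubgroup.index_dvd_of_le fun _ h => h.2⟩
  unbounded := by
    rintro _ ⟨U, rfl⟩ K
    obtain ⟨U', hU'⟩ := exists_openAddSubgroup_le_index (Ω := Ω) K
    exact ⟨_, ⟨U ⊓ U', rfl⟩, AddSubgroup.index_dvd_of_le fun _ h => h.1,
      hU'.trans (Nat.le_of_dvd (index_pos (U ⊓ U'))
        (AddSubgroup.index_dvd_of_le fun _ h => h.2))⟩

/-- A periodic sequence whose period is the index of an open subgroup extends to a continuous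
function on the group. -/
theorem exists_continuous_extension (hα : Dense (AddSubgroup.zmultiples α : Set Ω))
    (U : OpenAddSubgroup Ω) {v : ℤ → ℝ} (hv : ∀ n, v (n + U.toAddSubgroup.index) = v n) :
    ∃ g : C(Ω, ℝ), ∀ (ω : Ω) (a : ℤ), ω - a • α ∈ U → g ω = v a := by
  choose a ha using exists_zsmul_sub_mem hα U
  have hval : ∀ (ω : Ω) (b : ℤ), ω - b • α ∈ U → v (a ω) = v b := by
    intro ω b hb
    have h1 : (a ω - b) • α ∈ U := by
      have := U.sub_mem hb (ha ω)
      rwa [sub_sub_sub_cancel_left, ← sub_smul] at this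
    rw [zsmul_mem_iff hα] at h1
    rw [← periodic_emod hv (a ω), ← periodic_emod hv b, (Int.emod_emod_of_dvd _ dvd_rfl).symm,
      Int.emod_emod_of_dvd _ dvd_rfl, Int.emod_eq_emod_iff_emod_sub_eq_zero.mpr
        (Int.emod_eq_zero_of_dvd h1)]
  have hloc : IsLocallyConstant fun ω => v (a ω) := by
    rw [IsLocallyConstant.iff_eventually_eq]
    intro ω
    have ho : IsOpen {z : Ω | z - a ω • α ∈ (U : Set Ω)} :=
      U.isOpen.preimage (continuous_id.sub continuous_const)
    filter_upwards [ho.mem_nhds (ha ω)] with z hz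
    exact hval z (a ω) hz
  exact ⟨⟨fun ω => v (a ω), hloc.continuous⟩, hval⟩

theorem exists_openAddSubgroup_oscillation_le [T2Space Ω] [TotallyDisconnectedSpace Ω]
    (f : C(Ω, ℝ)) {ε : ℝ} (hε : 0 < ε) :
    ∃ U : OpenAddSubgroup Ω, ∀ ω z, ω - z ∈ U → |f ω - f z| ≤ ε := by
  have hnhds : ∀ᶠ u in 𝓝 (0 : Ω), ∀ z ∈ (Set.univ : Set Ω), |f (z + u) - f z| < ε := by
    refine isCompact_univ.eventually_forall_of_forall_eventually fun z _ => ?_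
    have hc : Continuous fun p : Ω × Ω => |f (p.2 + p.1) - f p.2| := by fun_prop
    exact hc.continuousAt.eventually_lt continuousAt_const (by simpa using hε)
  obtain ⟨U, hU⟩ := exists_openAddSubgroup_subset hnhds
  refine ⟨U, fun ω z h => ?_⟩
  have := hU h z (Set.mem_univ z)
  rw [add_sub_cancel] at this
  exact this.le

theorem potential_apply (f : C(Ω, ℝ)) (ω : Ω) (n : ℤ) : potential α f ω n = f (ω + n • α) := rfl

theorem shifted_schrodinger_apply (V : ℤ →ᵇ ℝ) (E : ℝ) (ψ : EllTwo) (n : ℤ) :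
    shifted (schrodinger V) E ψ n = residual (fun n => E - V n) ψ n := by
  rw [shifted_apply]
  change schrodinger V ψ n - E * ψ n = _
  rw [schrodinger_apply, residual]
  push_cast
  ring

theorem notMem_realSpectrum_of_boundedBelow {V : ℤ →ᵇ ℝ} {E c : ℝ} (hc : 0 < c)
    (h : BoundedBelow (fun n => E - V n) c) : E ∉ realSpectrum (schrodinger V) :=
  notMem_realSpectrum_of_bound (isSelfAdjoint_schrodinger V) hc fun ψ =>
    h ψ _ ⟨_, shifted_schrodinger_apply V E ψ, le_rfl⟩

/-! ### The generic set -/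

/-- For all `ω`, the spectrum of `H_{ω,f}` is covered by finitely many open intervals of total
length at most `2 δ`. -/
def HasThinSpectra (α : Ω) (δ : ℝ) (f : C(Ω, ℝ)) : Prop :=
  ∃ (F : Finset ℝ) (τ : ℝ), 0 < τ ∧ F.card * τ ≤ δ ∧ ∀ (ω : Ω) (E : ℝ),
    (∀ y ∈ F, τ ≤ |y - E|) → E ∉ realSpectrum (limitPeriodicOperator α f ω)

/-- A Gordon-type condition: for some `q ≥ k`, all eigenvectors with eigenvalue in `[-k, k]` of
all operators `H_{ω,f}` almost satisfy the three-term relation of a `q`-periodic operator. -/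
def IsGordonAt (α : Ω) (k : ℕ) (f : C(Ω, ℝ)) : Prop :=
  ∃ q : ℕ, k ≤ q ∧ ∀ (ω : Ω) (E : ℝ), |E| ≤ k → ∃ D : ℝ, ∀ ψ : EllTwo,
    shifted (limitPeriodicOperator α f ω) E ψ = 0 →
      L2Le (fun n => ψ (n + q) + ψ (n - q) - (D : ℂ) * ψ n) (1 / (k + 1) * ‖ψ‖)

/-- An eigenvector for `f` near `g` is an approximate solution for `g` with error at most `dist f g
* ‖ψ‖`, to which `discriminant_bound` applies. Its constant is uniform in `ω` and in `|E| ≤ k`, so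
one radius works for all. -/
theorem isGordonAt_of_periodic {N : ℕ} (hN : 0 < N) {g : C(Ω, ℝ)}
    (hg : ∀ ω, g (ω + N • α) = g ω) (k : ℕ) :
    ∃ r > 0, ∀ f ∈ Metric.ball g r, IsGordonAt α k f := by
  set q := N * k with hq
  have hperiod : ∀ ω n, potential α g ω (n + q) = potential α g ω n := by
    intro ω
    refine periodic_mul (x := potential α g ω) (fun n => ?_) k
    rw [potential_apply, potential_apply, add_smul, ← add_assoc, natCast_zsmul, hg]
  have hB : (0 : ℝ) ≤ k + ‖g‖ := by positivity
  obtain ⟨C, hC, hbound⟩ := discriminant_bound hB q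
  refine ⟨1 / (k + 1) / (C + 1), by positivity, fun f hf =>
    ⟨q, Nat.le_mul_of_pos_left k hN, fun ω E hE => ?_⟩⟩
  set x : ℤ → ℝ := fun n => E - potential α g ω n with hx
  refine ⟨(transferMatrix x q 0).trace, fun ψ hψ => ?_⟩
  rw [Metric.mem_ball] at hf
  set r : ℝ := 1 / (k + 1) / (C + 1) with hr
  have hr0 : 0 ≤ r := by positivity
  have hres : L2Le (residual x ψ) (r * ‖ψ‖) := by
    convert (L2Le.of_coe ψ).mul_left hr0
      (m := fun n => potential α g ω n - potential α f ω n) (fun n => ?_) using 1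
    · funext n
      have h0 : residual (fun n => E - potential α f ω n) ψ n = 0 := by
        rw [← shifted_schrodinger_apply]
        exact congrArg (fun φ : EllTwo => φ n) hψ
      simp only [residual, hx] at h0 ⊢
      push_cast at h0 ⊢
      linear_combination h0
    · rw [potential_apply, potential_apply, abs_sub_comm]
      exact (ContinuousMap.dist_apply_le_dist (f := f) (g := g) _).trans hf.le
  refine (hbound x (fun n => ?_) (fun n => ?_) ψ _ hres).mono ?_
  · refine (abs_sub _ _).trans (add_le_add hE ?_)
    exact g.norm_coe_le_norm _
  · simp only [hx, hperiod]
  · rw [← mul_assoc]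
    refine mul_le_mul_of_nonneg_right ?_ (norm_nonneg _)
    rw [hr, mul_div_assoc', div_le_iff₀ (by positivity)]
    have : (0 : ℝ) ≤ 1 / (k + 1) := by positivity
    nlinarith

theorem BoundedBelow.hasThinSpectra {g : C(Ω, ℝ)} {F : Finset ℝ} {τ δ c : ℝ} (hτ : 0 < τ)
    (hF : F.card * τ ≤ δ) (hc : 0 < c)
    (h : ∀ (ω : Ω) (E : ℝ), (∀ y ∈ F, τ ≤ |y - E|) →
      BoundedBelow (fun n => E - potential α g ω n) c) :
    ∀ f ∈ Metric.ball g (c / 2), HasThinSpectra α δ f := by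
  refine fun f hf => ⟨F, τ, hτ, hF, fun ω E hE => ?_⟩
  refine notMem_realSpectrum_of_boundedBelow (half_pos hc) ?_
  refine ((h ω E hE).perturb (half_pos hc).le fun n => ?_).mono (by linarith)
  rw [sub_sub_sub_cancel_left, potential_apply, potential_apply]
  exact (ContinuousMap.dist_apply_le_dist (f := f) (g := g) _).trans (Metric.mem_ball.mp hf).le

theorem exists_ball_hasThinSpectra [T2Space Ω] [TotallyDisconnectedSpace Ω] [PerfectSpace Ω]
    (hα : Dense (AddSubgroup.zmultiples α : Set Ω)) (f : C(Ω, ℝ)) {ε δ : ℝ} (hε : 0 < ε)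
    (hδ : 0 < δ) (k : ℕ) : ∃ g : C(Ω, ℝ), dist g f ≤ ε ∧ ∃ r > 0, ∀ f' ∈ Metric.ball g r,
      HasThinSpectra α δ f' ∧ IsGordonAt α k f' := by
  obtain ⟨U, hU⟩ := exists_openAddSubgroup_oscillation_le f (half_pos hε)
  set q := U.toAddSubgroup.index with hq
  -- Sampling `f` over one period along the orbit of 0 is accurate up to its oscillation on cosets
  -- of `U`.
  set v : ℤ → ℝ := fun n => f ((n % q) • α) with hv
  have hvper : ∀ n, v (n + q) = v n := fun n => by simp only [hv, Int.add_emod_right]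
  obtain ⟨N, ⟨U', rfl⟩, g₀, hper, hclose, F, τ, hτ, hF, c, hc, hb⟩ :=
    exists_thin_spectrum isPeriodSet_periods ⟨U, rfl⟩ hvper (half_pos hε) hδ
  obtain ⟨g, hg⟩ := exists_continuous_extension hα U' hper
  have hgper : ∀ ω, g (ω + U'.toAddSubgroup.index • α) = g ω := by
    intro ω
    obtain ⟨a, ha⟩ := exists_zsmul_sub_mem hα U' ω
    rw [hg ω a ha, hg _ (a + U'.toAddSubgroup.index) ?_, hper]
    rw [add_smul, natCast_zsmul, add_sub_add_right_eq_sub]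
    exact ha
  obtain ⟨r, hr, hgordon⟩ := isGordonAt_of_periodic (index_pos U') hgper k
  refine ⟨g, (ContinuousMap.dist_le hε.le).mpr fun ω => ?_, min (c / 2) r,
    lt_min (half_pos hc) hr, fun f' hf' => ⟨?_, hgordon f'
      (Metric.ball_subset_ball (min_le_right _ _) hf')⟩⟩
  · obtain ⟨a, ha⟩ := exists_zsmul_sub_mem hα (U ⊓ U') ω
    rw [hg ω a ha.2, Real.dist_eq]
    have h1 : |f ω - v a| ≤ ε / 2 := by
      refine hU _ _ ?_
      have h2 : (a - a % q) • α ∈ U := by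
        rw [zsmul_mem_iff hα]
        exact Int.dvd_self_sub_emod
      have := U.add_mem ha.1 h2
      rwa [sub_smul, sub_add_sub_cancel] at this
    have h2 := hclose a
    rw [abs_sub_comm] at h1
    calc |g₀ a - f ω| ≤ |g₀ a - v a| + |v a - f ω| := abs_sub_le _ _ _
      _ ≤ ε := by linarith
  · refine BoundedBelow.hasThinSpectra hτ hF hc (fun ω E hE => ?_) f'
      (Metric.ball_subset_ball (min_le_left _ _) hf')
    -- The potential of `g` at any `ω` is a translate of the single sequence `g₀`, so bounds for
    -- `g₀` hold for all `ω`.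
    obtain ⟨a, ha⟩ := exists_zsmul_sub_mem hα U' ω
    convert (hb E hE).shift a using 2 with n
    rw [potential_apply, hg _ (n + a)]
    rw [add_smul, add_comm (n • α), add_sub_add_right_eq_sub]
    exact ha

/-! ### Consequences for generic `f`: null spectrum and absence of eigenvalues -/

theorem volume_realSpectrum_eq_zero {f : C(Ω, ℝ)}
    (h : ∀ k : ℕ, HasThinSpectra α (1 / (k + 1)) f) (ω : Ω) :
    volume (realSpectrum (limitPeriodicOperator α f ω)) = 0 := by
  have hle : ∀ k : ℕ, volume (realSpectrum (limitPeriodicOperator α f ω))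
      ≤ ENNReal.ofReal (2 * (1 / (k + 1))) := by
    intro k
    obtain ⟨F, τ, hτ, hF, hspec⟩ := h k
    have hsub : realSpectrum (limitPeriodicOperator α f ω) ⊆ ⋃ y ∈ F, Metric.ball y τ := by
      intro E hE
      by_contra hcon
      refine hspec ω E (fun y hy => ?_) hE
      by_contra! hlt
      refine hcon (Set.mem_iUnion₂.mpr ⟨y, hy, ?_⟩)
      rwa [Metric.mem_ball, dist_comm, Real.dist_eq]
    refine (measure_mono hsub).trans ((measure_biUnion_finset_le _ _).trans ?_)
    simp only [Real.volume_ball, Finset.sum_const, nsmul_eq_mul]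
    rw [← ENNReal.ofReal_natCast, ← ENNReal.ofReal_mul (by positivity)]
    exact ENNReal.ofReal_le_ofReal (by linarith)
  have hlim : Filter.Tendsto (fun k : ℕ => ENNReal.ofReal (2 * (1 / ((k : ℝ) + 1))))
      Filter.atTop (𝓝 0) := by
    have := (tendsto_one_div_add_atTop_nhds_zero_nat (𝕜 := ℝ)).const_mul 2
    rw [mul_zero] at this
    simpa using ENNReal.tendsto_ofReal this
  exact le_antisymm (ge_of_tendsto' hlim hle) zero_le

theorem eventually_norm_lt (ψ : EllTwo) {ε : ℝ} (hε : 0 < ε) :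
    ∃ K : ℕ, ∀ n : ℤ, K ≤ n.natAbs → ‖ψ n‖ < ε := by
  have h1 := (summable_sq ψ).tendsto_cofinite_zero
  have h2 : {n : ℤ | ¬ ‖ψ n‖ ^ 2 < ε ^ 2}.Finite :=
    h1.eventually_lt_const (show (0 : ℝ) < ε ^ 2 by positivity)
  obtain ⟨K, hK⟩ := (h2.image Int.natAbs).bddAbove
  refine ⟨K + 1, fun n hn => ?_⟩
  by_contra! hle
  have h3 : n.natAbs ≤ K := hK (Set.mem_image_of_mem _
    (not_lt.mpr (pow_le_pow_left₀ hε.le hle 2)))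
  omega

/-- A three-block Gordon argument: the relation with step `q` ties `ψ n` to values at distance `q`
and `2 q`, which tend to zero as `q` grows. -/
theorem eq_zero_of_isGordonAt {f : C(Ω, ℝ)} (h : ∀ k : ℕ, IsGordonAt α k f) (ω : Ω) (E : ℝ)
    (ψ : EllTwo) (hψ : shifted (limitPeriodicOperator α f ω) E ψ = 0) : ψ = 0 := by
  by_contra hne
  obtain ⟨n, hn⟩ : ∃ n, ψ n ≠ 0 := by
    by_contra! hcon
    exact hne (lp.ext (funext hcon))
  set s := ‖ψ n‖ / 4 with hs
  have hs0 : 0 < s := by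
    have := norm_pos_iff.mpr hn
    positivity
  obtain ⟨K, hK⟩ := eventually_norm_lt ψ hs0
  obtain ⟨K', hK'⟩ := exists_nat_gt (max |E| (‖ψ‖ / s))
  have hKE : |E| < K' := (le_max_left _ _).trans_lt hK'
  have hKψ : ‖ψ‖ / s < K' := (le_max_right _ _).trans_lt hK'
  obtain ⟨k, hk⟩ : ∃ k : ℕ, k = K' + (K + n.natAbs) := ⟨_, rfl⟩
  have hkK : (K' : ℝ) ≤ k := by
    rw [hk]
    push_cast
    linarith [Nat.cast_nonneg (α := ℝ) K, Nat.cast_nonneg (α := ℝ) n.natAbs]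
  obtain ⟨q, hkq, hq⟩ := h k
  obtain ⟨D, hD⟩ := hq ω E (hKE.le.trans hkK)
  have hbound := hD ψ hψ
  have herr : 1 / ((k : ℝ) + 1) * ‖ψ‖ < s := by
    rw [one_div_mul_eq_div, div_lt_iff₀ (by positivity), mul_comm, ← div_lt_iff₀ hs0]
    linarith
  have h1 := hK (n + q) (by omega)
  have h2 := hK (n - q) (by omega)
  have h3 := hK (n + q + q) (by omega)
  have e1 := (hbound.norm_apply_le n).trans_lt herr
  have e2 := (hbound.norm_apply_le (n + q)).trans_lt herr
  rw [add_sub_cancel_right] at e2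
  have h4s : ‖ψ n‖ = 4 * s := by rw [hs]; ring
  -- For `|D| ≤ 1` the relation centred at `n + q` bounds `ψ n`, which has coefficient 1 there; for
  -- `|D| > 1` the relation centred at `n` does. Either way `‖ψ n‖ = 4 * s` is below `3 * s`.
  rcases le_or_gt |D| 1 with hD1 | hD1
  · have : ‖ψ n‖ ≤ ‖ψ (n + q + q) + ψ n - D * ψ (n + q)‖ + ‖ψ (n + q + q)‖
        + ‖(D : ℂ) * ψ (n + q)‖ := by
      calc ‖ψ n‖ = ‖(ψ (n + q + q) + ψ n - D * ψ (n + q)) - ψ (n + q + q) + D * ψ (n + q)‖ := by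
            congr 1
            ring
        _ ≤ _ := (norm_add_le _ _).trans (by gcongr; exact norm_sub_le _ _)
    rw [norm_mul, Complex.norm_real, Real.norm_eq_abs] at this
    have := mul_le_of_le_one_left (norm_nonneg (ψ (n + q))) hD1
    linarith
  · have : ‖(D : ℂ) * ψ n‖ ≤ ‖ψ (n + q)‖ + ‖ψ (n - q)‖
        + ‖ψ (n + q) + ψ (n - q) - D * ψ n‖ := by
      calc ‖(D : ℂ) * ψ n‖ = ‖ψ (n + q) + ψ (n - q) - (ψ (n + q) + ψ (n - q) - D * ψ n)‖ := by
            congr 1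
            ring
        _ ≤ _ := (norm_sub_le _ _).trans (by gcongr; exact norm_add_le _ _)
    rw [norm_mul, Complex.norm_real, Real.norm_eq_abs] at this
    have := le_mul_of_one_le_left (norm_nonneg (ψ n)) hD1.le
    linarith

theorem nontrivial_ellTwo : Nontrivial EllTwo :=
  ⟨lp.single 2 0 1, 0, fun h => by
    have := congrArg (fun φ : EllTwo => φ 0) h
    simp at this⟩

end CantorGroup

end LimitPeriodic

end

/-! ### The Baire category argument -/

theorem theoremt {Ω : Type*} [AddCommGroup Ω] [TopologicalSpace Ω] [IsTopologicalAddGroup Ω]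
    [T2Space Ω] [CompactSpace Ω] [TotallyDisconnectedSpace Ω] [PerfectSpace Ω]
    (α : Ω) (hα : Dense (AddSubgroup.zmultiples α : Set Ω)) :
    ∃ S : Set C(Ω, ℝ), IsGδ S ∧ Dense S ∧
      ∀ f ∈ S, ∀ ω : Ω,
        LimitPeriodic.IsCantorSet
          (LimitPeriodic.realSpectrum (LimitPeriodic.limitPeriodicOperator α f ω)) ∧
        volume (LimitPeriodic.realSpectrum (LimitPeriodic.limitPeriodicOperator α f ω)) = 0 ∧
        LimitPeriodic.HasPurelySingularContinuousSpectrum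
          (LimitPeriodic.limitPeriodicOperator α f ω) := by
  set G : ℕ → Set C(Ω, ℝ) := fun k => interior
    {f | LimitPeriodic.HasThinSpectra α (1 / (k + 1)) f ∧ LimitPeriodic.IsGordonAt α k f} with hG
  have hopen : ∀ k, IsOpen (G k) := fun k => isOpen_interior
  refine ⟨⋂ k, G k, IsGδ.iInter_of_isOpen hopen, dense_iInter_of_isOpen_nat hopen fun k => ?_,
    fun f hf ω => ?_⟩
  · refine Metric.dense_iff.mpr fun f ε hε => ?_
    obtain ⟨g, hgf, r, hr, hball⟩ := LimitPeriodic.exists_ball_hasThinSpectra hα f (half_pos hε)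
      (show (0 : ℝ) < 1 / (k + 1) by positivity) k
    exact ⟨g, Metric.mem_ball.mpr (by linarith),
      mem_interior.mpr ⟨_, hball, Metric.isOpen_ball, Metric.mem_ball_self hr⟩⟩
  · have hmem : ∀ k : ℕ, LimitPeriodic.HasThinSpectra α (1 / (k + 1)) f ∧
        LimitPeriodic.IsGordonAt α k f := fun k =>
      (interior_subset : G k ⊆ _) (Set.mem_iInter.mp hf k)
    have hvol := LimitPeriodic.volume_realSpectrum_eq_zero (fun k => (hmem k).1) ω
    have hinj := LimitPeriodic.eq_zero_of_isGordonAt (fun k => (hmem k).2) ω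
    have hsa := LimitPeriodic.isSelfAdjoint_schrodinger (LimitPeriodic.potential α f ω)
    have := LimitPeriodic.nontrivial_ellTwo
    exact ⟨LimitPeriodic.isCantorSet_realSpectrum hsa hvol hinj, hvol,
      LimitPeriodic.hasPurelySingularContinuousSpectrum hsa hvol hinj⟩
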